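/- **Series for the Riemann–Liouville fractional derivative.** For $\beta\in\mathbb C$ with $\operatorname{Re}\beta>0$ put $${}_0I_y^{\beta}f(y)=\frac1{\Gamma(\beta)}\int_0^y f(t)\,(y-t)^{\beta-1}\,dt ,\qquad\text{and}\qquad {}_0I_y^{0}f(y)=f(y).$$ For $\alpha\in\mathbb C$ let $n=n(\alpha)$ be the least integer $n\ge 0$ with $n=\alpha$ or $\operatorname{Re}(n-\alpha)>0$ (so for real $\alpha$: $n=\lceil\alpha\rceil$ if $\alpha>0$, and $n=0$ if $\alpha\le 0$), and put $${}_0D_x^{\alpha}f(x)=\frac{d^{n}}{dx^{n}}\,{}_0I_x^{\,n-\alpha}f(x).$$ Let $c_k=\binom{\alpha}{k}\frac{1}{\Gamma(k-\alpha+1)}$, where $1/\Gamma$ is $0$ at the poles of $\Gamma$. Let $\alpha\in\mathbb C$, $0<x<b$, and let $f$ be a complex-valued $C^\infty$ function on $(0,b)$. Suppose that 1. for some $\rho>0$ (for instance $\rho=1$), $\displaystyle\lim_{k\to\infty}\binom{\alpha}{k}\frac{\rho^{k}f^{(k)}(t)}{\Gamma(k+1-\alpha)}=0$ for every $t\in(0,x]$;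 2. the terms $c_k\,x^{k-\alpha}f^{(k)}(x)$ tend to $0$ as $k\to\infty$ (this follows from 1 if $x\le\rho$). Then ${}_0D_x^{\alpha}f(x)$ exists, in the sense that, if $\alpha\neq n$, the integral defining ${}_0I_y^{\,n-\alpha}f(y)$ converges absolutely for all $y$ near $x$, and that (in every case) the function $y\mapsto{}_0I_y^{\,n-\alpha}f(y)$ is $n$ times continuously differentiable at $x$. Moreover the series below converges (as the limit of its partial sums) and $${}_0D_x^{\alpha}f(x)=\sum_{k=0}^{\infty}\binom{\alpha}{k}\frac{x^{k-\alpha}}{\Gamma(k-\alpha+1)}\,f^{(k)}(x).$$ -/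

import Mathlib

open Filter Topology
open scoped ContDiff

/-- The Riemann–Liouville integral `₀I_y^β f (y)` with base point `0`:
`(1 / Γ(β)) ∫₀^y f(t) (y - t)^(β - 1) dt`, and the identity for `β = 0`.
It is used for `β = 0` and for `0 < Re β`. -/
noncomputable def rlIntegral (β : ℂ) (f : ℝ → ℂ) (y : ℝ) : ℂ :=
  if β = 0 then f y
  else (1 / Complex.Gamma β) * ∫ t in (0 : ℝ)..y, f t * ((y - t : ℝ) : ℂ) ^ (β - 1)

/-- The number `n` of ordinary derivatives in the Riemann–Liouville derivative of order `α`.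
For real `α` it is `0` if `α ≤ 0` and `⌈α⌉` if `0 < α`. For non-real `α` it is `0` if `Re α < 0`
and `⌊Re α⌋ + 1` if `0 ≤ Re α`. Thus it is the least natural number `n` for which
`n - α = 0` or `0 < Re (n - α)`. -/
noncomputable def rlOrder (α : ℂ) : ℕ :=
  if α.im = 0 then ⌈α.re⌉₊ else if α.re < 0 then 0 else ⌊α.re⌋₊ + 1

/-- The Riemann–Liouville derivative `₀D_x^α f (x) = dⁿ/dxⁿ ₀I_x^(n - α) f (x)`, `n = rlOrder α`.
For `n = 0` it is `₀I_x^(-α) f (x)`, and for `α = 0` it is `f x`. -/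
noncomputable def rlDeriv (α : ℂ) (f : ℝ → ℂ) (x : ℝ) : ℂ :=
  iteratedDeriv (rlOrder α) (rlIntegral ((rlOrder α : ℂ) - α) f) x

/-- The Riemann–Liouville derivative of order `α` of `f` exists at `x`: near `x` the fractional
integral that defines it converges absolutely, and it is `n` times continuously differentiable
at `x`. -/
def RLDifferentiableAt (α : ℂ) (f : ℝ → ℂ) (x : ℝ) : Prop :=
  ((rlOrder α : ℂ) - α ≠ 0 → ∀ᶠ y in 𝓝 x,
    IntervalIntegrable
      (fun t : ℝ => f t * ((y - t : ℝ) : ℂ) ^ ((rlOrder α : ℂ) - α - 1)) MeasureTheory.volume 0 y) ∧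
  ContDiffAt ℝ (rlOrder α) (rlIntegral ((rlOrder α : ℂ) - α) f) x

/-- The coefficient `binom(α, k) / Γ(k - α + 1)`. Since `Complex.Gamma` is `0` at its poles,
the quotient is `0` there, in agreement with the entire function `1 / Γ`. -/
noncomputable def rlCoeff (α : ℂ) (k : ℕ) : ℂ :=
  Ring.choose α k / Complex.Gamma ((k : ℂ) - α + 1)

/-- The `k`-th term `binom(α, k) x^(k - α) / Γ(k - α + 1) * f^(k)(x)` of the series. -/
noncomputable def rlTerm (α : ℂ) (f : ℝ → ℂ) (x : ℝ) (k : ℕ) : ℂ :=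
  rlCoeff α k * (x : ℂ) ^ ((k : ℂ) - α) * iteratedDeriv k f x

/-! For natural α the coefficients single out one ordinary derivative. Otherwise c_k = (-1)^k /
(Γ(-α) k! (k - α)). With D_k = (-x)^k f^(k)(x) / k!, the Taylor coefficients of v ↦ f(x(1 - v)), the
series is therefore x^(-α)/Γ(-α) times ∑ D_k / (k - α): formally, ∑ D_k v^k integrated against
v^(-α-1).

Hypothesis 1 bounds the Taylor radius of f below at each point of (0, x]. A Baire category argument
(`derivGrowth_Icc_of_pointwise`) makes the bounds uniform on every [a, x], with a radius r
independent of a. So f is analytic on (0, x), and a Taylor disc centred close to 0 extends it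
holomorphically past 0. By hypothesis 2 the series ∑ D_k z^k converges for |z| < 1. By the identity
theorem it represents f(x(1 - v)) on (0, 1), and it continues analytically across z = 1, the point
corresponding to t = 0.

Regularity at 1 passes to ∑ D_k z^k / (k - α) through a first-order differential equation
(`exists_analyticAt_one_div_add`). The coefficients tend to 0 by hypothesis 2, so Fatou's theorem
(`tendsto_sum_of_analyticAt_one`) gives convergence at z = 1 to the value of the continuation. That
value is also the Abel limit, which `tendsto_abel_rlIntegralDeriv` identifies with the fractional
derivative: termwise integration when the exponent has positive real part, then n steps that lower
the exponent by one. The boundary terms at 0 match those of the n-fold derivative because f is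
smooth across 0. -/

section

/-! ### Taylor series and the Pringsheim–Boas theorem. -/

open scoped Nat

/-- The derivative of `u ↦ ∑_{j ≤ m} g_j(u) (s - u)^j / j!` telescopes. -/
theorem hasDerivAt_sum_taylor {g : ℕ → ℝ → ℂ} {u : ℝ}
    (hg : ∀ k, HasDerivAt (g k) (g (k + 1) u) u) (s : ℝ) (m : ℕ) :
    HasDerivAt (fun u : ℝ => ∑ j ∈ Finset.range (m + 1), g j u * (((s - u : ℝ) : ℂ) ^ j / j !))
      (g (m + 1) u * (((s - u : ℝ) : ℂ) ^ m / m !)) u := by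
  have hpow : ∀ j : ℕ, HasDerivAt (fun u : ℝ => ((s - u : ℝ) : ℂ) ^ (j + 1) / ((j + 1)! : ℂ))
      (-(((s - u : ℝ) : ℂ) ^ j / j !)) u := by
    intro j
    have h1 : HasDerivAt (fun u : ℝ => ((s - u : ℝ) : ℂ)) (-1) u := by
      have := ((hasDerivAt_id u).const_sub s).ofReal_comp
      simpa using this
    have h2 := (h1.pow (j + 1)).div_const ((j + 1)! : ℂ)
    refine h2.congr_deriv ?_
    have : ((j ! : ℕ) : ℂ) ≠ 0 := by exact_mod_cast Nat.factorial_ne_zero j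
    have h3 : ((j : ℂ) + 1) ≠ 0 := by exact_mod_cast Nat.succ_ne_zero j
    rw [Nat.factorial_succ]
    push_cast
    field_simp
  induction m with
  | zero =>
    simpa using hg 0
  | succ m ih =>
    have h1 := ih.add ((hg (m + 1)).mul (hpow m))
    have h2 : (fun u : ℝ => ∑ j ∈ Finset.range (m + 1 + 1),
        g j u * (((s - u : ℝ) : ℂ) ^ j / j !)) = (fun u : ℝ => ∑ j ∈ Finset.range (m + 1),
        g j u * (((s - u : ℝ) : ℂ) ^ j / j !)) +
        g (m + 1) * fun u : ℝ => ((s - u : ℝ) : ℂ) ^ (m + 1) / ((m + 1)! : ℂ) := by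
      funext u
      rw [Finset.sum_range_succ]
      rfl
    rw [h2]
    refine h1.congr_deriv ?_
    ring

/-- Mean value inequality in the base point u: at u = s the Taylor sum collapses to g 0 s, at u = t
it is the Taylor polynomial, and its u-derivative is a single term. -/
theorem norm_sub_sum_taylor_le {g : ℕ → ℝ → ℂ} {s t M : ℝ} (m : ℕ)
    (hg : ∀ u ∈ Set.uIcc s t, ∀ k, HasDerivAt (g k) (g (k + 1) u) u)
    (hM : ∀ u ∈ Set.uIcc s t, ‖g (m + 1) u‖ ≤ M) :
    ‖g 0 s - ∑ j ∈ Finset.range (m + 1), g j t * (((s - t : ℝ) : ℂ) ^ j / j !)‖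
      ≤ M * |s - t| ^ (m + 1) / m ! := by
  have hM0 : 0 ≤ M := (norm_nonneg _).trans (hM s Set.left_mem_uIcc)
  have key := (convex_uIcc s t).norm_image_sub_le_of_norm_hasDerivWithin_le
    (f := fun u : ℝ => ∑ j ∈ Finset.range (m + 1), g j u * (((s - u : ℝ) : ℂ) ^ j / j !))
    (f' := fun u => g (m + 1) u * (((s - u : ℝ) : ℂ) ^ m / m !)) (C := M * (|s - t| ^ m / m !))
    (fun u hu => (hasDerivAt_sum_taylor (hg u hu) s m).hasDerivWithinAt)
    (fun u hu => ?_) Set.right_mem_uIcc Set.left_mem_uIcc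
  · have h0 : ∑ j ∈ Finset.range (m + 1), g j s * (((s - s : ℝ) : ℂ) ^ j / j !) = g 0 s := by
      rw [Finset.sum_range_succ']
      simp
    simp only [h0] at key
    refine key.trans (le_of_eq ?_)
    rw [Real.norm_eq_abs]
    ring
  · rw [norm_mul, norm_div, norm_pow, Complex.norm_real, Real.norm_eq_abs, Complex.norm_natCast]
    have : |s - u| ≤ |s - t| := by
      rw [abs_sub_comm s u, abs_sub_comm s t]
      exact Set.abs_sub_left_of_mem_uIcc hu
    gcongr
    exact hM u hu

/-- Bounds `‖g_k‖ ≤ C k! / r ^ k` on a set, uniform in `k`. -/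
def DerivGrowth (g : ℕ → ℝ → ℂ) (r : ℝ) (S : Set ℝ) : Prop :=
  ∃ C : ℝ, ∀ t ∈ S, ∀ k : ℕ, ‖g k t‖ ≤ C * (k ! / r ^ k)

theorem DerivGrowth.mono {g : ℕ → ℝ → ℂ} {r : ℝ} {S T : Set ℝ} (h : DerivGrowth g r T)
    (hST : S ⊆ T) : DerivGrowth g r S :=
  h.imp fun _ hC t ht => hC t (hST ht)

theorem DerivGrowth.union {g : ℕ → ℝ → ℂ} {r : ℝ} (hr : 0 < r) {S T : Set ℝ}
    (hS : DerivGrowth g r S) (hT : DerivGrowth g r T) : DerivGrowth g r (S ∪ T) := by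
  obtain ⟨C, hC⟩ := hS
  obtain ⟨D, hD⟩ := hT
  refine ⟨max C D, ?_⟩
  rintro t (ht | ht) k
  · exact (hC t ht k).trans (by gcongr; exact le_max_left _ _)
  · exact (hD t ht k).trans (by gcongr; exact le_max_right _ _)

/-- The remainder is at most C (m + 1) q^(m+1) with q = |s - t| / r < 1; the factor m + 1 lost in
the mean value inequality is harmless. -/
theorem hasSum_taylor {g : ℕ → ℝ → ℂ} {s t r : ℝ} (hr : 0 < r)
    (hg : ∀ u ∈ Set.uIcc s t, ∀ k, HasDerivAt (g k) (g (k + 1) u) u)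
    (hG : DerivGrowth g r (Set.uIcc s t)) (hst : |s - t| < r) :
    HasSum (fun j : ℕ => g j t * (((s - t : ℝ) : ℂ) ^ j / j !)) (g 0 s) := by
  obtain ⟨C, hC⟩ := hG
  set q := |s - t| / r with hq
  have hq0 : 0 ≤ q := by positivity
  have hq1 : q < 1 := (div_lt_one hr).2 hst
  have hsum : Summable (fun j : ℕ => g j t * (((s - t : ℝ) : ℂ) ^ j / j !)) := by
    refine Summable.of_norm_bounded ((summable_geometric_of_lt_one hq0 hq1).mul_left C) fun j => ?_
    rw [norm_mul, norm_div, norm_pow, Complex.norm_real, Real.norm_eq_abs, Complex.norm_natCast]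
    calc _ ≤ C * (j ! / r ^ j) * (|s - t| ^ j / j !) := by
          gcongr; exact hC t Set.right_mem_uIcc j
      _ = C * q ^ j := by
          rw [hq, div_pow]
          have : (j ! : ℝ) ≠ 0 := by positivity
          field_simp
  rw [hsum.hasSum_iff_tendsto_nat]
  rw [← tendsto_add_atTop_iff_nat 1]
  rw [tendsto_iff_norm_sub_tendsto_zero]
  have hlim : Tendsto (fun m : ℕ => C * ((((m + 1 : ℕ) : ℝ)) ^ 1 * q ^ (m + 1))) atTop (𝓝 0) := by
    have := (tendsto_pow_const_mul_const_pow_of_lt_one 1 hq0 hq1).comp (tendsto_add_atTop_nat 1)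
    simpa using this.const_mul C
  refine squeeze_zero (fun _ => norm_nonneg _) (fun m => ?_) hlim
  rw [norm_sub_rev]
  refine (norm_sub_sum_taylor_le m hg fun u hu => hC u hu (m + 1)).trans (le_of_eq ?_)
  rw [hq, div_pow, Nat.factorial_succ]
  have : (m ! : ℝ) ≠ 0 := by positivity
  push_cast
  field_simp

/-- Growth bounds at `p` propagate to `t` along an interval on which Taylor series converge. -/
theorem norm_le_of_growth_transfer {g : ℕ → ℝ → ℂ} {p t R C : ℝ} (hR : 0 < R)
    (hg : ∀ u ∈ Set.uIcc t p, ∀ k, HasDerivAt (g k) (g (k + 1) u) u)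
    (hG : DerivGrowth g (R / 2) (Set.uIcc t p)) (htp : |t - p| ≤ R / 8)
    (hp : ∀ k : ℕ, ‖g k p‖ ≤ C * (k ! / R ^ k)) (k : ℕ) :
    ‖g k t‖ ≤ (2 * C) * (k ! / (R / 2) ^ k) := by
  have hC0 : 0 ≤ C := by
    have := (norm_nonneg _).trans (hp 0)
    simpa using this
  -- Since (k + j)! ≤ 2^(k+j) k! j!, shifting the index by k only halves the radius. The constant
  -- depends on k, but it serves only to make the Taylor series at p converge and does not enter the
  -- final bound.
  have hG' : DerivGrowth (fun j => g (k + j)) (R / 4) (Set.uIcc t p) := by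
    obtain ⟨D, hD⟩ := hG
    refine ⟨D * (k ! * 2 ^ k / (R / 2) ^ k), fun u hu j => ?_⟩
    have hD0 : 0 ≤ D := by
      have := (norm_nonneg _).trans (hD u hu 0)
      simpa using this
    refine (hD u hu (k + j)).trans ?_
    have h1 : ((k + j)! : ℝ) ≤ 2 ^ (k + j) * (k ! * j !) := by
      have h2 : (k + j).choose k ≤ 2 ^ (k + j) := Nat.choose_le_two_pow _ _
      have h3 : (k + j).choose k * k ! * j ! = (k + j)! := by
        rw [Nat.choose_symm_add]
        exact Nat.add_choose_mul_factorial_mul_factorial k j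
      have h4 : ((k + j).choose k : ℝ) * k ! * j ! = (k + j)! := by exact_mod_cast h3
      rw [← h4, mul_assoc]
      gcongr
      exact_mod_cast h2
    calc D * ((k + j)! / (R / 2) ^ (k + j))
        ≤ D * (2 ^ (k + j) * (k ! * j !) / (R / 2) ^ (k + j)) := by gcongr
      _ = D * (k ! * 2 ^ k / (R / 2) ^ k) * (j ! / (R / 4) ^ j) := by
          rw [pow_add, pow_add, show R / 4 = (R / 2) / 2 by ring, div_pow (R / 2) 2 j]
          field_simp
  have hsum := hasSum_taylor (g := fun j => g (k + j)) (by positivity : 0 < R / 4)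
    (fun u hu j => hg u hu (k + j)) hG' (htp.trans_lt (by linarith))
  set q : ℝ := 1 / 8 with hq
  -- The sum of binom(j + k, k) q^j is (1 - q)^(-k-1). For q = 1/8 this is (8/7)^(k+1) ≤ 2^(k+1),
  -- whence the factor 2 and the halved radius.
  have hgeo := (hasSum_choose_mul_geometric_of_norm_lt_one k
    (r := q) (by rw [hq]; norm_num)).mul_left (C * (k ! / R ^ k))
  have hle : ‖g k t‖ ≤ C * (k ! / R ^ k) * (1 / (1 - q) ^ (k + 1)) := by
    have := tsum_of_norm_bounded hgeo (f := fun j : ℕ => g (k + j) p * (((t - p : ℝ) : ℂ) ^ j / j !)) ?_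
    · rwa [hsum.tsum_eq] at this
    · intro j
      rw [norm_mul, norm_div, norm_pow, Complex.norm_real, Real.norm_eq_abs, Complex.norm_natCast]
      have h3 : (k + j).choose k * k ! * j ! = (k + j)! := by
        rw [Nat.choose_symm_add]
        exact Nat.add_choose_mul_factorial_mul_factorial k j
      have h4 : ((k + j).choose k : ℝ) * k ! * j ! = (k + j)! := by exact_mod_cast h3
      calc ‖g (k + j) p‖ * (|t - p| ^ j / j !)
          ≤ C * ((k + j)! / R ^ (k + j)) * ((R / 8) ^ j / j !) := by
            gcongr; exact hp _
        _ = C * (k ! / R ^ k) * (((j + k).choose k : ℝ) * q ^ j) := by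
            rw [← h4, pow_add, div_pow, hq, div_pow, one_pow, add_comm j k]
            have : (j ! : ℝ) ≠ 0 := by positivity
            field_simp
  refine hle.trans ?_
  calc C * (k ! / R ^ k) * (1 / (1 - q) ^ (k + 1))
      ≤ C * (k ! / R ^ k) * 2 ^ (k + 1) := by
        gcongr
        rw [← one_div_pow]
        exact pow_le_pow_left₀ (by rw [hq]; norm_num) (by rw [hq]; norm_num) _
    _ = 2 * C * (k ! / (R / 2) ^ k) := by
        rw [div_pow, pow_succ]
        field_simp

/-- The Pringsheim–Boas theorem: if the Taylor series at every point of `[a, x]` has radius of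
convergence bounded below, then the derivatives satisfy uniform Cauchy type bounds. -/
theorem derivGrowth_Icc_of_pointwise {g : ℕ → ℝ → ℂ} {a x R : ℝ} (hR : 0 < R)
    (hg : ∀ u ∈ Set.Icc a x, ∀ k, HasDerivAt (g k) (g (k + 1) u) u)
    (hpt : ∀ t ∈ Set.Icc a x, ∃ C : ℝ, ∀ k : ℕ, ‖g k t‖ ≤ C * (k ! / R ^ k)) :
    DerivGrowth g (R / 2) (Set.Icc a x) := by
  set K := Set.Icc a x with hK
  have hR2 : 0 < R / 2 := by positivity
  have hcompact : ∀ S : Set ℝ, IsCompact S →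
      (∀ t ∈ S, ∃ V ∈ 𝓝[S] t, DerivGrowth g (R / 2) V) → DerivGrowth g (R / 2) S :=
    fun S hS h => hS.induction_on ⟨0, by simp⟩ (fun _ _ hst ht => ht.mono hst)
      (fun _ _ hs ht => hs.union hR2 ht) h
  apply hcompact K isCompact_Icc
  by_contra! hbad
  -- The closed set of bad points. If it is nonempty, a uniform bound is produced near one of its
  -- points, which is a contradiction.
  set E : Set ℝ := {t | t ∈ K ∧ ∀ ε > 0, ¬ DerivGrowth g (R / 2) (K ∩ Metric.ball t ε)} with hE
  have hEne : E.Nonempty := by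
    obtain ⟨t, htK, ht⟩ := hbad
    refine ⟨t, htK, fun ε hε => ht _ ?_⟩
    exact inter_mem self_mem_nhdsWithin (mem_nhdsWithin_of_mem_nhds (Metric.ball_mem_nhds t hε))
  have hEclosed : IsClosed E := by
    refine isClosed_of_closure_subset fun t ht => ?_
    rw [Metric.mem_closure_iff] at ht
    refine ⟨?_, fun ε hε hgood => ?_⟩
    · have hcl : IsClosed K := isClosed_Icc
      rw [← hcl.closure_eq, Metric.mem_closure_iff]
      intro ε hε
      obtain ⟨b, hb, hb'⟩ := ht ε hε
      exact ⟨b, hb.1, hb'⟩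
    · obtain ⟨b, hb, hb'⟩ := ht (ε / 2) (by positivity)
      refine hb.2 (ε / 2) (by positivity) (hgood.mono ?_)
      refine Set.inter_subset_inter_right _ (Metric.ball_subset_ball' ?_)
      rw [dist_comm]
      linarith
  have hEK : E ⊆ K := fun t ht => ht.1
  have hgc : ∀ k, ContinuousOn (g k) K := fun k t ht => (hg t ht k).continuousAt.continuousWithinAt
  have : Nonempty E := hEne.to_subtype
  have : CompleteSpace E := hEclosed.completeSpace_coe
  -- Baire category on the complete space E: a single constant C works on a relatively open part of
  -- E.
  obtain ⟨C, z, hz⟩ := nonempty_interior_of_iUnion_of_closed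
    (f := fun C : ℕ => {t : E | ∀ k : ℕ, ‖g k t‖ ≤ C * (k ! / R ^ k)})
    (fun C => by
      rw [Set.ofPred_forall]
      refine isClosed_iInter fun k => ?_
      refine isClosed_le ?_ continuous_const
      exact ((hgc k).comp_continuous continuous_subtype_val fun t => hEK t.2).norm)
    (by
      refine Set.eq_univ_of_forall fun t => ?_
      obtain ⟨C, hC⟩ := hpt t (hEK t.2)
      obtain ⟨n, hn⟩ := exists_nat_ge C
      refine Set.mem_iUnion.2 ⟨n, fun k => (hC k).trans ?_⟩
      gcongr)
  obtain ⟨ε, hε, hball⟩ := Metric.mem_nhds_iff.1 (mem_interior_iff_mem_nhds.1 hz)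
  have hEC : ∀ t ∈ E, |t - z| < ε → ∀ k : ℕ, ‖g k t‖ ≤ C * (k ! / R ^ k) :=
    fun t ht htz => hball (show (⟨t, ht⟩ : E) ∈ Metric.ball z ε from htz)
  refine z.2.2 (min ε (R / 8)) (by positivity) ⟨2 * C, fun t ht => ?_⟩
  obtain ⟨htK, htz⟩ := ht
  rw [Metric.mem_ball, Real.dist_eq] at htz
  have hzE := z.2
  set z' : ℝ := z.1
  -- c is the point of E closest to t on the segment from z to t. It carries the uniform constant C,
  -- and all points strictly closer to t have local bounds.
  obtain ⟨c, hcS, hcmin⟩ := (isCompact_uIcc (a := z') (b := t)).inter_left hEclosed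
    |>.exists_isMinOn (f := fun u => |u - t|) ⟨z', hzE, Set.left_mem_uIcc⟩ (by fun_prop)
  obtain ⟨hcE, hcz⟩ := hcS
  have hsub : Set.uIcc t c ⊆ Set.uIcc z' t := Set.uIcc_subset_uIcc Set.right_mem_uIcc hcz
  have hsubK : Set.uIcc z' t ⊆ K := Set.ordConnected_Icc.uIcc_subset (hEK hzE) htK
  have hcz' : |c - z'| < ε := by
    have := Set.abs_sub_left_of_mem_uIcc hcz
    exact this.trans_lt (htz.trans_le (min_le_left _ _))
  have htc : |t - c| ≤ R / 8 := by
    have h1 := Set.abs_sub_right_of_mem_uIcc hcz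
    exact h1.trans (htz.le.trans (min_le_right _ _))
  refine norm_le_of_growth_transfer hR (fun u hu => hg u (hsubK (hsub hu))) ?_ htc (hEC c hcE hcz')
  obtain ⟨Ct, hCt⟩ := hpt t htK
  -- The constant here may depend on t, since the bound only ensures convergence of Taylor series.
  -- Points p ≠ c inherit it from t, as the segment from p to t avoids E. The transfer from c to t
  -- then yields 2 * C, uniformly in t.
  have hbound : DerivGrowth g (R / 2) ({c} ∪ (Set.uIcc t c \ {c})) := by
    refine DerivGrowth.union hR2 ?_ ⟨2 * Ct, fun p hp => ?_⟩
    · refine ⟨C, ?_⟩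
      rintro _ rfl k
      refine (hEC _ hcE hcz' k).trans ?_
      gcongr
      linarith
    · obtain ⟨hp, hpc⟩ := hp
      have hpc' : p ≠ c := hpc
      have hpt' : |p - t| < |c - t| := by
        rcases Set.mem_uIcc.1 hp with ⟨h1, h2⟩ | ⟨h1, h2⟩
        · rw [abs_of_nonneg (by linarith), abs_of_nonneg (by linarith)]
          have := lt_of_le_of_ne h2 hpc'
          linarith
        · rw [abs_of_nonpos (by linarith), abs_of_nonpos (by linarith)]
          have := lt_of_le_of_ne h1 hpc'.symm
          linarith
      have hpsub : Set.uIcc p t ⊆ Set.uIcc t c := by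
        rw [Set.uIcc_comm t c]
        exact Set.uIcc_subset_uIcc (by rwa [Set.uIcc_comm]) Set.right_mem_uIcc
      refine norm_le_of_growth_transfer hR
        (fun u hu => hg u (hsubK (hsub (hpsub hu)))) ?_ ?_ hCt
      · refine hcompact _ isCompact_uIcc fun u hu => ?_
        have huE : u ∉ E := by
          intro huE
          have h1 : |c - t| ≤ |u - t| := hcmin ⟨huE, hsub (hpsub hu)⟩
          have h2 : |u - t| ≤ |p - t| := by
            have := Set.abs_sub_right_of_mem_uIcc hu
            rwa [abs_sub_comm t u, abs_sub_comm t p] at this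
          linarith
        have huK : u ∈ K := hsubK (hsub (hpsub hu))
        have : ∃ δ > 0, DerivGrowth g (R / 2) (K ∩ Metric.ball u δ) := by
          by_contra! h
          exact huE ⟨huK, h⟩
        obtain ⟨δ, hδ, hgood⟩ := this
        refine ⟨K ∩ Metric.ball u δ, ?_, hgood⟩
        refine nhdsWithin_mono u ((hpsub.trans hsub).trans hsubK) ?_
        exact inter_mem self_mem_nhdsWithin (mem_nhdsWithin_of_mem_nhds (Metric.ball_mem_nhds u hδ))
      · have : |c - t| ≤ R / 8 := by rwa [abs_sub_comm]
        exact hpt'.le.trans this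
  refine hbound.mono fun u hu => ?_
  by_cases h : u = c
  · exact Or.inl h
  · exact Or.inr ⟨hu, h⟩

end

/-! ### Fourier localization of the boundary values of a power series. -/

section

open scoped FourierTransform

/-- A continuous function supported near `0`, equal to `1` at `0`, whose Fourier transform at the
integers decays like `j⁻³` and sums to `1`. -/
theorem exists_localizer {δ : ℝ} (hδ : 0 < δ) (hδ1 : δ ≤ 1) :
    ∃ L : ℝ → ℂ, Continuous L ∧ HasCompactSupport L ∧ (∀ s, δ ≤ |s| → L s = 0) ∧
      (∃ B : ℝ, 0 ≤ B ∧ ∀ j : ℤ, ‖𝓕 L j‖ ≤ B / (1 + |(j : ℝ)|) ^ 3) ∧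
      ∑' j : ℤ, 𝓕 L (j : ℝ) = 1 := by
  let φ : ContDiffBump (0 : ℝ) := ⟨δ / 2, δ, by positivity, by linarith⟩
  have hsmooth : ContDiff ℝ ∞ (fun s => (φ s : ℂ)) := Complex.ofRealCLM.contDiff.comp φ.contDiff
  have hcs : HasCompactSupport (fun s => (φ s : ℂ)) :=
    φ.hasCompactSupport.comp_left (g := fun x : ℝ => (x : ℂ)) (by simp)
  have hzero : ∀ s, δ ≤ |s| → φ s = 0 := fun s hs => by
    apply φ.zero_of_le_dist
    simpa [Real.dist_eq] using hs
  let Φ : SchwartzMap ℝ ℂ := hcs.toSchwartzMap hsmooth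
  have hΦ : (Φ : ℝ → ℂ) = fun s => (φ s : ℂ) := rfl
  refine ⟨fun s => (φ s : ℂ), hsmooth.continuous, hcs, fun s hs => by simp [hzero s hs], ?_, ?_⟩
  · obtain ⟨C0, hC0, h0⟩ := (𝓕 Φ).decay 0 0
    obtain ⟨C3, hC3, h3⟩ := (𝓕 Φ).decay 3 0
    refine ⟨4 * (C0 + C3), by positivity, fun j => ?_⟩
    have h0' := h0 j
    have h3' := h3 j
    simp only [norm_iteratedFDeriv_zero, SchwartzMap.fourier_coe, hΦ, pow_zero, one_mul,
      Real.norm_eq_abs] at h0' h3'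
    rw [le_div_iff₀ (by positivity)]
    set y := |(j : ℝ)| with hy
    have hy0 : 0 ≤ y := abs_nonneg _
    have hpow : (1 + y) ^ 3 ≤ 4 * (1 + y ^ 3) := by nlinarith [mul_nonneg hy0 (sq_nonneg (y - 1)), sq_nonneg (y - 1)]
    calc ‖𝓕 (fun s => (φ s : ℂ)) (j : ℝ)‖ * (1 + y) ^ 3
        ≤ ‖𝓕 (fun s => (φ s : ℂ)) (j : ℝ)‖ * (4 * (1 + y ^ 3)) := by gcongr
      _ ≤ 4 * (C0 + C3) := by linarith
  · have h := SchwartzMap.tsum_eq_tsum_fourier Φ 0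
    rw [SchwartzMap.fourier_coe, hΦ] at h
    simp only [zero_add, QuotientAddGroup.mk_zero] at h
    have h2 : ∑' n : ℤ, ((φ (n : ℝ) : ℝ) : ℂ) = 1 := by
      rw [tsum_eq_single 0]
      · have : φ (0 : ℝ) = 1 := φ.one_of_mem_closedBall (Metric.mem_closedBall_self φ.rIn_pos.le)
        simp [this]
      · intro n hn
        rw [hzero]
        · simp
        · refine hδ1.trans ?_
          exact_mod_cast Int.one_le_abs hn
    rw [h2] at h
    rw [h]
    refine tsum_congr fun j => ?_
    simp

/-- Because k + 1 ≤ (N + 1)(1 + |N - k|), linear growth against cubic decay leaves a square, which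
is summable in k. -/
theorem norm_mul_fourier_le {S : ℕ → ℂ} {M B : ℝ} (hM : 0 ≤ M)
    (hS : ∀ k, ‖S k‖ ≤ M * (k + 1)) {Λ : ℤ → ℂ} (hΛ : ∀ j : ℤ, ‖Λ j‖ ≤ B / (1 + |(j : ℝ)|) ^ 3)
    (N k : ℕ) :
    ‖S k * Λ ((N : ℤ) - k)‖ ≤ M * B * (N + 1) * (1 / (1 + |(((N : ℤ) - k : ℤ) : ℝ)|) ^ 2) := by
  rw [norm_mul]
  set y := |(((N : ℤ) - k : ℤ) : ℝ)| with hy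
  have hy0 : 0 ≤ y := abs_nonneg _
  have hk : (k : ℝ) + 1 ≤ (N + 1) * (1 + y) := by
    have h1 : (k : ℝ) - N ≤ y := by
      have := neg_le_abs (((N : ℤ) - k : ℤ) : ℝ)
      push_cast at this hy
      linarith
    have hN : (0 : ℝ) ≤ N := Nat.cast_nonneg N
    nlinarith
  calc ‖S k‖ * ‖Λ ((N : ℤ) - k)‖ ≤ (M * ((N + 1) * (1 + y))) * (B / (1 + y) ^ 3) := by
        gcongr
        · exact (hS k).trans (by gcongr)
        · exact hΛ _
    _ = M * B * (N + 1) * (1 / (1 + y) ^ 2) := by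
        field_simp

theorem summable_int_inv_one_add_abs_sq :
    Summable (fun j : ℤ => 1 / (1 + |(j : ℝ)|) ^ 2) := by
  have h : Summable (fun n : ℕ => 1 / (1 + (n : ℝ)) ^ 2) := by
    have := (summable_nat_add_iff 1).2 (Real.summable_one_div_nat_pow.2 one_lt_two)
    refine this.congr fun n => ?_
    push_cast
    ring
  refine Summable.of_nat_of_neg ?_ ?_
  · simpa using h
  · simpa using h

theorem fourier_mul_fourierChar_pow (L : ℝ → ℂ) (N k : ℕ) :
    ∫ s : ℝ, 𝐞 (-(s * N)) • (L s * (𝐞 s : ℂ) ^ k) = 𝓕 L (((N : ℤ) - k : ℤ) : ℝ) := by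
  rw [Real.fourier_real_eq]
  congr 1
  funext s
  have : -(s * (((N : ℤ) - k : ℤ) : ℝ)) = -(s * N) + k • s := by
    push_cast
    rw [nsmul_eq_mul]
    ring
  rw [this, AddChar.map_add_eq_mul, AddChar.map_nsmul_eq_pow, Circle.smul_def, Circle.smul_def,
    Circle.coe_mul, Circle.coe_pow, smul_eq_mul, smul_eq_mul]
  ring

/-- H is controlled only on the ball; outside |s| < δ the factor L vanishes, so nothing about H is
needed there. -/
theorem aestronglyMeasurable_localized {L : ℝ → ℂ} (hL : Continuous L) {δ ε : ℝ}
    (hL0 : ∀ s, δ ≤ |s| → L s = 0) {H : ℂ → ℂ} (hH : ContinuousOn H (Metric.ball 1 ε)) {r : ℝ}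
    (hr : ∀ s : ℝ, |s| < δ → (r : ℂ) * 𝐞 s ∈ Metric.ball (1 : ℂ) ε) (N : ℕ) :
    MeasureTheory.AEStronglyMeasurable
      (fun s : ℝ => 𝐞 (-(s * N)) • (L s * H ((r : ℂ) * 𝐞 s))) := by
  have hset : MeasurableSet {s : ℝ | |s| < δ} :=
    (isOpen_lt continuous_abs continuous_const).measurableSet
  have hind : (fun s : ℝ => 𝐞 (-(s * N)) • (L s * H ((r : ℂ) * 𝐞 s))) =
      Set.indicator {s : ℝ | |s| < δ} (fun s : ℝ => 𝐞 (-(s * N)) • (L s * H ((r : ℂ) * 𝐞 s))) := by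
    funext s
    by_cases hs : |s| < δ
    · rw [Set.indicator_of_mem (show s ∈ {s : ℝ | |s| < δ} from hs)]
    · rw [Set.indicator_of_notMem (show s ∉ {s : ℝ | |s| < δ} from hs), hL0 s (not_lt.1 hs)]
      simp
  rw [hind, aestronglyMeasurable_indicator_iff hset]
  refine ContinuousOn.aestronglyMeasurable ?_ hset
  have hc : Continuous fun s : ℝ => ((𝐞 s : Circle) : ℂ) := by fun_prop
  have hc' : Continuous fun s : ℝ => ((𝐞 (-(s * N)) : Circle) : ℂ) := by fun_prop
  simp only [Circle.smul_def, smul_eq_mul]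
  refine hc'.continuousOn.mul (hL.continuousOn.mul ?_)
  exact hH.comp (continuous_const.mul hc).continuousOn fun s hs => hr s hs

/-- Localized coefficients of `∑ S_k z^k` as Fourier integrals of its boundary values. -/
theorem tsum_mul_fourier_eq_integral {S : ℕ → ℂ} {M B CH δ ε : ℝ} (hM : 0 ≤ M)
    (hδ : 0 < δ) (hS : ∀ k, ‖S k‖ ≤ M * (k + 1)) {L : ℝ → ℂ} (hL : Continuous L)
    (hLc : HasCompactSupport L) (hL0 : ∀ s, δ ≤ |s| → L s = 0)
    (hΛ : ∀ j : ℤ, ‖𝓕 L (j : ℝ)‖ ≤ B / (1 + |(j : ℝ)|) ^ 3)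
    {H : ℂ → ℂ} (hH : ContinuousOn H (Metric.ball 1 ε)) (hCH : ∀ z ∈ Metric.ball (1 : ℂ) ε, ‖H z‖ ≤ CH)
    (hsum : ∀ z ∈ Metric.ball (1 : ℂ) ε, ‖z‖ < 1 → HasSum (fun k => S k * z ^ k) (H z))
    (hball : ∀ r s : ℝ, |r - 1| < δ → |s| < δ → (r : ℂ) * 𝐞 s ∈ Metric.ball (1 : ℂ) ε) (N : ℕ) :
    ∑' k : ℕ, S k * 𝓕 L (((N : ℤ) - k : ℤ) : ℝ) =
      ∫ s : ℝ, 𝐞 (-(s * N)) • (L s * H (𝐞 s)) := by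
  have hLint : MeasureTheory.Integrable L := hL.integrable_of_hasCompactSupport hLc
  have hev : ∀ᶠ r : ℝ in 𝓝[<] 1, 0 < r ∧ r < 1 ∧ |r - 1| < δ := by
    have h1 : ∀ᶠ r : ℝ in 𝓝 1, 0 < r := lt_mem_nhds one_pos
    have h2 : ∀ᶠ r : ℝ in 𝓝 1, |r - 1| < δ := Metric.ball_mem_nhds 1 hδ
    filter_upwards [self_mem_nhdsWithin, mem_nhdsWithin_of_mem_nhds h1,
      mem_nhdsWithin_of_mem_nhds h2] with r hr hr1 hr2
    exact ⟨hr1, hr, hr2⟩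
  -- Inside the disc the geometric factor r^k justifies exchanging sum and integral. The identity is
  -- then carried to r = 1 by dominated convergence on both sides.
  have hinside : ∀ r : ℝ, 0 < r ∧ r < 1 ∧ |r - 1| < δ →
      ∑' k : ℕ, S k * r ^ k * 𝓕 L (((N : ℤ) - k : ℤ) : ℝ) =
        ∫ s : ℝ, 𝐞 (-(s * N)) • (L s * H ((r : ℂ) * 𝐞 s)) := by
    rintro r ⟨hr0, hr1, hrδ⟩
    have hgeo : Summable (fun k : ℕ => M * (k + 1) * r ^ k) := by
      have h1 := summable_pow_mul_geometric_of_norm_lt_one 1 (r := r)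
        (by rwa [Real.norm_eq_abs, abs_of_pos hr0])
      have h2 := summable_geometric_of_lt_one hr0.le hr1
      refine ((h1.add h2).mul_left M).congr fun k => ?_
      ring
    have key := MeasureTheory.hasSum_integral_of_dominated_convergence (μ := MeasureTheory.volume)
      (F := fun (k : ℕ) (s : ℝ) => 𝐞 (-(s * N)) • (L s * (S k * ((r : ℂ) * 𝐞 s) ^ k)))
      (f := fun s => 𝐞 (-(s * N)) • (L s * H ((r : ℂ) * 𝐞 s)))
      (fun k s => ‖L s‖ * (M * (k + 1) * r ^ k)) (fun k => ?_) (fun k => ?_) ?_ ?_ ?_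
    · rw [← key.tsum_eq]
      refine tsum_congr fun k => ?_
      rw [← fourier_mul_fourierChar_pow, ← MeasureTheory.integral_const_mul]
      congr 1
      funext s
      rw [Circle.smul_def, Circle.smul_def, smul_eq_mul, smul_eq_mul, mul_pow]
      ring
    · refine Continuous.aestronglyMeasurable ?_
      simp only [Circle.smul_def, smul_eq_mul]
      fun_prop
    · refine Eventually.of_forall fun s => ?_
      rw [Circle.norm_smul, norm_mul, norm_mul, norm_pow, norm_mul, Circle.norm_coe, mul_one,
        Complex.norm_real, Real.norm_eq_abs, abs_of_pos hr0]
      gcongr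
      exact hS k
    · exact Eventually.of_forall fun s => hgeo.mul_left _
    · simp only [tsum_mul_left]
      exact hLint.norm.mul_const _
    · refine Eventually.of_forall fun s => ?_
      by_cases hs : |s| < δ
      · have hz := hball r s hrδ hs
        have hn : ‖(r : ℂ) * 𝐞 s‖ < 1 := by
          rw [norm_mul, Circle.norm_coe, mul_one, Complex.norm_real, Real.norm_eq_abs,
            abs_of_pos hr0]
          exact hr1
        exact ((hsum _ hz hn).mul_left (L s)).const_smul _
      · simp only [hL0 s (not_lt.1 hs), zero_mul, smul_zero]
        exact hasSum_zero
  have hofReal : Tendsto (fun r : ℝ => (r : ℂ)) (𝓝[<] 1) (𝓝 1) := by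
    have : Tendsto (fun r : ℝ => (r : ℂ)) (𝓝 1) (𝓝 ((1 : ℝ) : ℂ)) :=
      Complex.continuous_ofReal.tendsto 1
    simpa using this.mono_left nhdsWithin_le_nhds
  -- The decay of 𝓕 L provides a majorant independent of r, although ∑ S k itself need not converge.
  have hlim1 : Tendsto (fun r : ℝ => ∑' k : ℕ, S k * (r : ℂ) ^ k * 𝓕 L (((N : ℤ) - k : ℤ) : ℝ))
      (𝓝[<] 1) (𝓝 (∑' k : ℕ, S k * 𝓕 L (((N : ℤ) - k : ℤ) : ℝ))) := by
    refine tendsto_tsum_of_dominated_convergence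
      (bound := fun k : ℕ => M * B * (N + 1) * (1 / (1 + |(((N : ℤ) - k : ℤ) : ℝ)|) ^ 2)) ?_ ?_ ?_
    · refine Summable.mul_left _ ?_
      exact summable_int_inv_one_add_abs_sq.comp_injective
        (i := fun k : ℕ => (N : ℤ) - k) fun a b hab => by simpa using hab
    · intro k
      have := ((hofReal.pow k).const_mul (S k)).mul_const (𝓕 L (((N : ℤ) - k : ℤ) : ℝ))
      simpa using this
    · filter_upwards [hev] with r hr k
      refine le_trans ?_ (norm_mul_fourier_le hM hS (Λ := fun j => 𝓕 L (j : ℝ)) hΛ N k)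
      rw [norm_mul, norm_mul, norm_mul, norm_pow, Complex.norm_real, Real.norm_eq_abs,
        abs_of_pos hr.1]
      gcongr
      exact mul_le_of_le_one_right (norm_nonneg _) (pow_le_one₀ hr.1.le hr.2.1.le)
  have hlim2 : Tendsto (fun r : ℝ => ∫ s : ℝ, 𝐞 (-(s * N)) • (L s * H ((r : ℂ) * 𝐞 s)))
      (𝓝[<] 1) (𝓝 (∫ s : ℝ, 𝐞 (-(s * N)) • (L s * H (𝐞 s)))) := by
    refine MeasureTheory.tendsto_integral_filter_of_dominated_convergence
      (fun s => ‖L s‖ * CH) ?_ ?_ (hLint.norm.mul_const _) ?_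
    · filter_upwards [hev] with r hr
      exact aestronglyMeasurable_localized hL hL0 hH (fun s hs => hball r s hr.2.2 hs) N
    · filter_upwards [hev] with r hr
      refine Eventually.of_forall fun s => ?_
      rw [Circle.norm_smul, norm_mul]
      by_cases hs : |s| < δ
      · gcongr
        exact hCH _ (hball r s hr.2.2 hs)
      · simp [hL0 s (not_lt.1 hs)]
    · refine Eventually.of_forall fun s => ?_
      by_cases hs : |s| < δ
      · refine Tendsto.const_smul (Tendsto.const_mul _ ?_) _
        have hz := hball 1 s (by simpa using hδ) hs
        rw [Complex.ofReal_one, one_mul] at hz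
        have h1 : ContinuousAt H (𝐞 s : ℂ) := hH.continuousAt (Metric.isOpen_ball.mem_nhds hz)
        refine h1.tendsto.comp ?_
        simpa using hofReal.mul_const (𝐞 s : ℂ)
      · simp [hL0 s (not_lt.1 hs)]
  refine tendsto_nhds_unique hlim1 (hlim2.congr' ?_)
  filter_upwards [hev] with r hr
  exact (hinside r hr).symm

end

/-! ### Fatou's theorem on convergence at a regular boundary point. -/

section

open scoped FourierTransform

/-- The sum `e_0 + ⋯ + e_m`, which is `0` for `m < 0`. -/
noncomputable def intPartialSum (e : ℕ → ℂ) (m : ℤ) : ℂ := ∑ k ∈ Finset.range (m + 1).toNat, e k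

theorem intPartialSum_natCast (e : ℕ → ℂ) (k : ℕ) :
    intPartialSum e k = ∑ i ∈ Finset.range (k + 1), e i := by
  rw [intPartialSum]
  congr 2

theorem intPartialSum_of_neg (e : ℕ → ℂ) {m : ℤ} (hm : m < 0) : intPartialSum e m = 0 := by
  rw [intPartialSum, Int.toNat_of_nonpos (by omega), Finset.sum_range_zero]

theorem intPartialSum_sub_pred (e : ℕ → ℂ) {m : ℤ} (hm : 0 ≤ m) :
    intPartialSum e m - intPartialSum e (m - 1) = e m.toNat := by
  obtain ⟨n, rfl⟩ := Int.eq_ofNat_of_zero_le hm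
  rw [intPartialSum_natCast, Finset.sum_range_succ, intPartialSum]
  simp

/-- Linear in the shift and uniform in position: against the cubic decay of the localizer it is the
majorant for letting N tend to infinity under a sum over shifts. -/
theorem norm_intPartialSum_sub_le {e : ℕ → ℂ} {M : ℝ} (hM : 0 ≤ M) (he : ∀ k, ‖e k‖ ≤ M)
    (m m' : ℤ) : ‖intPartialSum e m - intPartialSum e m'‖ ≤ M * |((m - m' : ℤ) : ℝ)| := by
  have key : ∀ (m : ℤ) (d : ℕ), ‖intPartialSum e (m + d) - intPartialSum e m‖ ≤ M * d := by
    intro m d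
    induction d with
    | zero => simp
    | succ d ih =>
      have h1 : ‖intPartialSum e (m + (d + 1 : ℕ)) - intPartialSum e (m + d)‖ ≤ M := by
        have h2 : m + (d : ℤ) = m + ((d + 1 : ℕ) : ℤ) - 1 := by push_cast; ring
        rcases lt_or_ge (m + ((d + 1 : ℕ) : ℤ)) 0 with h | h
        · rw [intPartialSum_of_neg e h, intPartialSum_of_neg e (by omega)]
          simpa using hM
        · rw [h2, intPartialSum_sub_pred e h]
          exact he _
      have h3 := norm_add_le (intPartialSum e (m + (d + 1 : ℕ)) - intPartialSum e (m + d))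
        (intPartialSum e (m + d) - intPartialSum e m)
      rw [sub_add_sub_cancel] at h3
      refine h3.trans ((add_le_add h1 ih).trans (le_of_eq ?_))
      push_cast
      ring
  rcases le_total m' m with h | h
  · obtain ⟨d, hd⟩ := Int.eq_ofNat_of_zero_le (sub_nonneg.2 h)
    have := key m' d
    rw [← hd, add_sub_cancel] at this
    rw [hd]
    simpa using this
  · obtain ⟨d, hd⟩ := Int.eq_ofNat_of_zero_le (sub_nonneg.2 h)
    have := key m d
    rw [← hd, add_sub_cancel] at this
    rw [norm_sub_rev, ← neg_sub m' m, hd]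
    simpa using this

/-- For a fixed shift the difference is a bounded number of terms of e whose indices go to infinity.
-/
theorem tendsto_intPartialSum_sub {e : ℕ → ℂ} (he : Tendsto e atTop (𝓝 0)) (j : ℤ) :
    Tendsto (fun N : ℤ => intPartialSum e N - intPartialSum e (N - j)) atTop (𝓝 0) := by
  have h1 : Tendsto (fun m : ℤ => intPartialSum e m - intPartialSum e (m - 1)) atTop (𝓝 0) := by
    have h2 : Tendsto (fun m : ℤ => e m.toNat) atTop (𝓝 0) := by
      refine he.comp (tendsto_atTop_atTop.2 fun b => ⟨b, fun a ha => ?_⟩)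
      omega
    refine h2.congr' ?_
    filter_upwards [eventually_ge_atTop 0] with m hm
    exact (intPartialSum_sub_pred e hm).symm
  have hshift : ∀ c : ℤ, Tendsto (fun m : ℤ => m - c) atTop atTop := fun c =>
    tendsto_atTop_add_const_right _ (-c) tendsto_id
  induction j using Int.induction_on with
  | zero => simp
  | succ j ih =>
    have := ih.add (h1.comp (hshift j))
    rw [add_zero] at this
    refine this.congr fun m => ?_
    simp only [Function.comp, sub_sub]
    ring
  | pred j ih =>
    have := ih.sub (h1.comp (hshift (-j - 1)))
    rw [sub_zero] at this
    refine this.congr fun m => ?_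
    simp only [Function.comp]
    rw [show m - (-(j : ℤ) - 1) - 1 = m - -j by ring]
    ring

/-- Fatou's theorem, normalized so that the sum at the regular point `1` vanishes. -/
theorem tendsto_sum_of_hasSum_partialSum {e : ℕ → ℂ} (he : Tendsto e atTop (𝓝 0)) {H : ℂ → ℂ}
    {ε CH : ℝ} (hε : 0 < ε) (hH : ContinuousOn H (Metric.ball 1 ε))
    (hCH : ∀ z ∈ Metric.ball (1 : ℂ) ε, ‖H z‖ ≤ CH)
    (hsum : ∀ z ∈ Metric.ball (1 : ℂ) ε, ‖z‖ < 1 →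
      HasSum (fun k => (∑ i ∈ Finset.range (k + 1), e i) * z ^ k) (H z)) :
    Tendsto (fun N => ∑ i ∈ Finset.range (N + 1), e i) atTop (𝓝 0) := by
  obtain ⟨M, hM⟩ : ∃ M : ℝ, ∀ k, ‖e k‖ ≤ M := by
    obtain ⟨M, hM⟩ := he.norm.bddAbove_range
    exact ⟨M, fun k => hM ⟨k, rfl⟩⟩
  have hM0 : 0 ≤ M := (norm_nonneg _).trans (hM 0)
  obtain ⟨δ, hδ, hδ1, hball⟩ : ∃ δ > 0, δ ≤ 1 ∧ ∀ r s : ℝ, |r - 1| < δ → |s| < δ →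
      (r : ℂ) * 𝐞 s ∈ Metric.ball (1 : ℂ) ε := by
    have hc : Continuous fun p : ℝ × ℝ => (p.1 : ℂ) * (𝐞 p.2 : ℂ) := by fun_prop
    have h0 : Tendsto (fun p : ℝ × ℝ => (p.1 : ℂ) * (𝐞 p.2 : ℂ)) (𝓝 (1, 0)) (𝓝 1) := by
      simpa using hc.tendsto (1, 0)
    obtain ⟨δ, hδ, h⟩ := Metric.mem_nhds_iff.1 (h0 (Metric.ball_mem_nhds 1 hε))
    refine ⟨min δ 1, by positivity, min_le_right _ _, fun r s hr hs => ?_⟩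
    refine h (show (r, s) ∈ Metric.ball ((1 : ℝ), (0 : ℝ)) δ from ?_)
    rw [Metric.mem_ball, Prod.dist_eq, max_lt_iff, Real.dist_eq, Real.dist_eq]
    refine ⟨hr.trans_le (min_le_left _ _), ?_⟩
    simpa using hs.trans_le (min_le_left _ _)
  obtain ⟨L, hL, hLc, hL0, ⟨B, hB, hΛ⟩, hone⟩ := exists_localizer hδ hδ1
  -- Since ∑ 𝓕 L j = 1, S N = ∑ (S N - S (N - j)) 𝓕 L j + ∑ S (N - j) 𝓕 L j. The first sum tends to
  -- 0 by dominated convergence, the second by the Riemann–Lebesgue lemma.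
  set S := intPartialSum e with hSdef
  have hSn : ∀ k : ℕ, ‖∑ i ∈ Finset.range (k + 1), e i‖ ≤ M * (k + 1) := by
    intro k
    refine (norm_sum_le_of_le _ fun i _ => hM i).trans (le_of_eq ?_)
    simp
    ring
  have hint := fun N : ℕ => tsum_mul_fourier_eq_integral hM0 hδ hSn hL hLc hL0 hΛ hH hCH hsum hball N
  have hRL : Tendsto (fun N : ℕ => ∑' k : ℕ, (∑ i ∈ Finset.range (k + 1), e i) *
      𝓕 L (((N : ℤ) - k : ℤ) : ℝ)) atTop (𝓝 0) := by
    simp only [hint]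
    exact (Real.tendsto_integral_exp_smul_cocompact fun s => L s * H (𝐞 s)).comp
      ((tendsto_natCast_atTop_atTop (R := ℝ)).mono_right atTop_le_cocompact)
  -- Substitution k = N - j; the indices N - j < 0 contribute nothing because `intPartialSum`
  -- vanishes there.
  have hconv : ∀ N : ℕ, ∑' k : ℕ, (∑ i ∈ Finset.range (k + 1), e i) *
      𝓕 L (((N : ℤ) - k : ℤ) : ℝ) = ∑' j : ℤ, S (N - j) * 𝓕 L (j : ℝ) := by
    intro N
    rw [← (Equiv.subLeft (N : ℤ)).tsum_eq]
    simp only [Equiv.subLeft_apply, sub_sub_cancel]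
    rw [← (Nat.cast_injective (R := ℤ)).tsum_eq]
    · refine tsum_congr fun k => ?_
      rw [hSdef, intPartialSum_natCast]
    · intro m hm
      by_contra hm'
      refine hm ?_
      have : m < 0 := by
        by_contra h
        exact hm' ⟨m.toNat, Int.toNat_of_nonneg (not_lt.1 h)⟩
      simp only [hSdef]
      rw [intPartialSum_of_neg e this, zero_mul]
  simp only [hconv] at hRL
  have hb : ∀ j : ℤ, |(j : ℝ)| * ‖𝓕 L (j : ℝ)‖ ≤ B * (1 / (1 + |(j : ℝ)|) ^ 2) := by
    intro j
    calc |(j : ℝ)| * ‖𝓕 L (j : ℝ)‖ ≤ (1 + |(j : ℝ)|) * (B / (1 + |(j : ℝ)|) ^ 3) := by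
          gcongr
          · linarith
          · exact hΛ j
      _ = B * (1 / (1 + |(j : ℝ)|) ^ 2) := by field_simp
  have hbd : ∀ (N : ℕ) (j : ℤ), ‖(S N - S (N - j)) * 𝓕 L (j : ℝ)‖ ≤
      M * (B * (1 / (1 + |(j : ℝ)|) ^ 2)) := by
    intro N j
    rw [norm_mul]
    have h1 := norm_intPartialSum_sub_le hM0 hM N (N - j)
    rw [sub_sub_cancel] at h1
    calc ‖S N - S (N - j)‖ * ‖𝓕 L (j : ℝ)‖ ≤ M * |(j : ℝ)| * ‖𝓕 L (j : ℝ)‖ := by gcongr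
      _ = M * (|(j : ℝ)| * ‖𝓕 L (j : ℝ)‖) := by ring
      _ ≤ _ := mul_le_mul_of_nonneg_left (hb j) hM0
  have hsumΛ : Summable fun j : ℤ => 𝓕 L (j : ℝ) := by
    refine Summable.of_norm_bounded (summable_int_inv_one_add_abs_sq.mul_left B) fun j => ?_
    refine (hΛ j).trans ?_
    rw [mul_one_div]
    gcongr
    · linarith [abs_nonneg (j : ℝ)]
    · norm_num
  have hdiff : Tendsto (fun N : ℕ => ∑' j : ℤ, (S N - S (N - j)) * 𝓕 L (j : ℝ)) atTop (𝓝 0) := by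
    have := tendsto_tsum_of_dominated_convergence (f := fun (N : ℕ) (j : ℤ) => (S N - S (N - j)) * 𝓕 L (j : ℝ)) (g := fun _ => 0)
      (bound := fun j : ℤ => M * (B * (1 / (1 + |(j : ℝ)|) ^ 2)))
      ((summable_int_inv_one_add_abs_sq.mul_left B).mul_left M) (fun j => ?_)
      (Eventually.of_forall (f := (atTop : Filter ℕ)) hbd)
    · simpa using this
    · have h1 := (tendsto_intPartialSum_sub he j).comp (tendsto_natCast_atTop_atTop (R := ℤ))
      simpa using h1.mul_const (𝓕 L (j : ℝ))
  have hfin := hdiff.add hRL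
  rw [add_zero] at hfin
  refine hfin.congr fun N => ?_
  have hsumd : Summable fun j : ℤ => (S N - S (N - j)) * 𝓕 L (j : ℝ) := by
    refine Summable.of_norm_bounded
      ((summable_int_inv_one_add_abs_sq.mul_left B).mul_left M) (hbd N)
  have hsum2 : Summable fun j : ℤ => S (N - j) * 𝓕 L (j : ℝ) := by
    have := (hsumΛ.mul_left (S N)).sub hsumd
    refine this.congr fun j => ?_
    ring
  rw [← hsumd.tsum_add hsum2, ← intPartialSum_natCast]
  calc ∑' j : ℤ, ((S N - S (N - j)) * 𝓕 L (j : ℝ) + S (N - j) * 𝓕 L (j : ℝ))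
      = ∑' j : ℤ, S N * 𝓕 L (j : ℝ) := tsum_congr fun j => by ring
    _ = S N := by rw [tsum_mul_left, hone, mul_one]

/-- Fatou's theorem: a power series whose coefficients tend to `0` converges at the boundary point
`1` if its sum is regular there. -/
theorem tendsto_sum_of_analyticAt_one {e : ℕ → ℂ} (he : Tendsto e atTop (𝓝 0)) {G : ℂ → ℂ}
    (hG : AnalyticAt ℂ G 1)
    (hsum : ∀ᶠ z in 𝓝 (1 : ℂ), ‖z‖ < 1 → HasSum (fun k => e k * z ^ k) (G z)) :
    Tendsto (fun N => ∑ i ∈ Finset.range N, e i) atTop (𝓝 (G 1)) := by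
  -- Subtracting G 1 from the constant term makes the expected sum 0. The partial sums then have
  -- generating function (G z - G 1) / (1 - z) = -`dslope` G 1 z, which is regular at 1.
  set e' : ℕ → ℂ := fun k => e k - if k = 0 then G 1 else 0 with he'
  have he'0 : Tendsto e' atTop (𝓝 0) := by
    refine he.congr' ?_
    filter_upwards [eventually_gt_atTop 0] with k hk
    simp [he', hk.ne']
  have hH : AnalyticAt ℂ (dslope G 1) 1 := by
    obtain ⟨p, hp⟩ := hG
    exact ⟨_, hp.has_fpower_series_dslope_fslope⟩
  have hb : ∀ᶠ z in 𝓝 (1 : ℂ), ‖-dslope G 1 z‖ < ‖-dslope G 1 1‖ + 1 :=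
    hH.continuousAt.neg.norm.eventually (gt_mem_nhds (lt_add_one _))
  obtain ⟨ε, hε, hball⟩ := Metric.mem_nhds_iff.1
    (hb.and (hsum.and hH.eventually_analyticAt))
  obtain ⟨M, hM⟩ : ∃ M : ℝ, ∀ k, ‖e' k‖ ≤ M := by
    obtain ⟨M, hM⟩ := he'0.norm.bddAbove_range
    exact ⟨M, fun k => hM ⟨k, rfl⟩⟩
  have key := tendsto_sum_of_hasSum_partialSum (e := e') he'0 (H := fun z => -dslope G 1 z) hε
    (fun z hz => ((hball hz).2.2.continuousAt.neg).continuousWithinAt)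
    (fun z hz => (hball hz).1.le) (fun z hz hz1 => ?_)
  · rw [← tendsto_add_atTop_iff_nat 1]
    have := key.add_const (G 1)
    rw [zero_add] at this
    refine this.congr fun N => ?_
    simp [he', Finset.sum_sub_distrib]
  · have h1 : HasSum (fun k => e' k * z ^ k) (G z - G 1) := by
      have h2 := ((hball hz).2.1 hz1).sub (hasSum_ite_eq 0 (G 1))
      refine h2.congr_fun fun k => ?_
      by_cases hk : k = 0 <;> simp [he', hk]
    have hgeo : Summable (fun k : ℕ => M * (k + 1) * ‖z‖ ^ k) := by
      have h1 := summable_pow_mul_geometric_of_norm_lt_one 1 (r := ‖z‖) (by rwa [norm_norm])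
      have h2 := summable_geometric_of_lt_one (norm_nonneg z) hz1
      refine ((h1.add h2).mul_left M).congr fun k => ?_
      ring
    have hS : Summable fun k : ℕ => (∑ i ∈ Finset.range (k + 1), e' i) * z ^ k := by
      refine Summable.of_norm_bounded hgeo fun k => ?_
      rw [norm_mul, norm_pow]
      gcongr
      refine (norm_sum_le_of_le _ fun i _ => hM i).trans (le_of_eq ?_)
      simp
      ring
    have hz' : z ≠ 1 := by
      rintro rfl
      simp at hz1
    have hval : (1 - z) * ∑' k : ℕ, (∑ i ∈ Finset.range (k + 1), e' i) * z ^ k = G z - G 1 := by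
      have h2 := hS.tsum_eq_zero_add
      have h3 := h1.summable.tsum_eq_zero_add
      have h4 : ∑' k : ℕ, (∑ i ∈ Finset.range (k + 1 + 1), e' i) * z ^ (k + 1) -
          z * ∑' k : ℕ, (∑ i ∈ Finset.range (k + 1), e' i) * z ^ k =
          ∑' k : ℕ, e' (k + 1) * z ^ (k + 1) := by
        rw [← tsum_mul_left, ← ((summable_nat_add_iff 1).2 hS).tsum_sub (hS.mul_left z)]
        refine tsum_congr fun k => ?_
        rw [Finset.sum_range_succ _ (k + 1)]
        ring
      rw [h1.tsum_eq] at h3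
      simp only [zero_add, Finset.sum_range_one] at h2
      linear_combination h2 + h4 - h3
    have : -dslope G 1 z = ∑' k : ℕ, (∑ i ∈ Finset.range (k + 1), e' i) * z ^ k := by
      rw [dslope_of_ne _ hz', slope_def_field, ← hval]
      have : z - 1 ≠ 0 := sub_ne_zero.2 hz'
      field_simp
      ring
    simp only [this]
    exact hS.hasSum

end

/-! ### Derivatives of the fractional integral of a function smooth across 0. -/

theorem eqOn_iteratedDeriv_of_hasDerivAt {F : ℕ → ℝ → ℂ} {U : Set ℝ} (hU : IsOpen U)
    (hF : ∀ u ∈ U, ∀ k, HasDerivAt (F k) (F (k + 1) u) u) (k : ℕ) :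
    Set.EqOn (iteratedDeriv k (F 0)) (F k) U := by
  induction k with
  | zero => intro u _; simp
  | succ k ih =>
    intro u hu
    rw [iteratedDeriv_succ, (ih.eventuallyEq_of_mem (hU.mem_nhds hu)).deriv_eq]
    exact (hF u hu k).deriv

theorem contDiffOn_of_hasDerivAt {F : ℕ → ℝ → ℂ} {U : Set ℝ} (hU : IsOpen U)
    (hF : ∀ u ∈ U, ∀ k, HasDerivAt (F k) (F (k + 1) u) u) (n : ℕ) :
    ∀ k, ContDiffOn ℝ n (F k) U := by
  induction n with
  | zero =>
    intro k
    exact contDiffOn_zero.2 fun u hu => (hF u hu k).continuousAt.continuousWithinAt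
  | succ n ih =>
    intro k
    push_cast
    rw [contDiffOn_succ_iff_deriv_of_isOpen hU]
    refine ⟨fun u hu => (hF u hu k).differentiableAt.differentiableWithinAt, by simp, ?_⟩
    exact (ih (k + 1)).congr fun u hu => (hF u hu k).deriv

/-- The fractional integral after the substitution `t = y (1 - v)`. -/
noncomputable def scaledIntegral (β : ℂ) (f : ℝ → ℂ) (y : ℝ) : ℂ :=
  ∫ v in (0 : ℝ)..1, f (y * (1 - v)) * (v : ℂ) ^ (β - 1)

/-- After this substitution neither the interval nor the singular kernel depends on y, so
differentiation under the integral falls on f alone. -/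
theorem rlIntegral_eq_scaledIntegral {β : ℂ} (hβ : 0 < β.re) (f : ℝ → ℂ) {y : ℝ} (hy : 0 < y) :
    rlIntegral β f y = (y : ℂ) ^ β / Complex.Gamma β * scaledIntegral β f y := by
  have hβ0 : β ≠ 0 := by
    rintro rfl
    simp at hβ
  have hyc : (y : ℂ) ≠ 0 := by exact_mod_cast hy.ne'
  rw [rlIntegral, if_neg hβ0]
  have h := intervalIntegral.smul_integral_comp_sub_mul (a := 0) (b := 1)
    (fun t : ℝ => f t * ((y - t : ℝ) : ℂ) ^ (β - 1)) y y
  simp only [mul_one, mul_zero, sub_self, sub_zero] at h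
  rw [← h, scaledIntegral]
  have h2 : ∫ v in (0 : ℝ)..1, f (y - y * v) * ((y - (y - y * v) : ℝ) : ℂ) ^ (β - 1) =
      (y : ℂ) ^ (β - 1) * ∫ v in (0 : ℝ)..1, f (y * (1 - v)) * (v : ℂ) ^ (β - 1) := by
    rw [← intervalIntegral.integral_const_mul]
    refine intervalIntegral.integral_congr fun v hv => ?_
    rw [Set.uIcc_of_le zero_le_one] at hv
    rw [sub_sub_cancel, Complex.ofReal_mul, Complex.mul_cpow_ofReal_nonneg hy.le hv.1,
      mul_sub, mul_one]
    ring
  rw [h2, Complex.cpow_sub _ _ hyc, Complex.cpow_one, Complex.real_smul]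
  field_simp

theorem intervalIntegrable_mul_cpow {β : ℂ} (hβ : 0 < β.re) {h : ℝ → ℂ}
    (hh : ContinuousOn h (Set.Icc 0 1)) :
    IntervalIntegrable (fun v : ℝ => h v * (v : ℂ) ^ (β - 1)) MeasureTheory.volume 0 1 := by
  have h1 : IntervalIntegrable (fun v : ℝ => (v : ℂ) ^ (β - 1)) MeasureTheory.volume 0 1 :=
    intervalIntegral.intervalIntegrable_cpow' (by simpa using hβ)
  exact h1.continuousOn_mul (by rwa [Set.uIcc_of_le zero_le_one])

theorem mul_one_sub_mem {η b y v : ℝ} (hη : 0 < η) (hy : y ∈ Set.Ioo 0 b) (hv : v ∈ Set.Icc (0 : ℝ) 1) :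
    y * (1 - v) ∈ Set.Ioo (-η) b := by
  have h1 : 0 ≤ y * (1 - v) := mul_nonneg hy.1.le (by linarith [hv.2])
  have h2 : y * (1 - v) ≤ y := mul_le_of_le_one_right hy.1.le (by linarith [hv.1])
  exact ⟨by linarith, by linarith [hy.2]⟩

theorem hasDerivAt_scaledIntegral {β : ℂ} (hβ : 0 < β.re) {f f' : ℝ → ℂ} {η b : ℝ} (hη : 0 < η)
    (hf : ∀ u ∈ Set.Ioo (-η) b, HasDerivAt f (f' u) u) (hf' : ContinuousOn f' (Set.Ioo (-η) b))
    {y : ℝ} (hy : y ∈ Set.Ioo 0 b) :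
    HasDerivAt (scaledIntegral β f)
      (∫ v in (0 : ℝ)..1, ((1 - v : ℝ) : ℂ) * f' (y * (1 - v)) * (v : ℂ) ^ (β - 1)) y := by
  have hfc : ContinuousOn f (Set.Ioo (-η) b) := fun u hu => (hf u hu).continuousAt.continuousWithinAt
  have hmaps : ∀ z ∈ Set.Ioo 0 b, Set.MapsTo (fun v : ℝ => z * (1 - v)) (Set.Icc 0 1)
      (Set.Ioo (-η) b) := fun z hz v hv => mul_one_sub_mem hη hz hv
  -- (0, c) is a neighbourhood of y, and f' is bounded on the compact [0, c]; this gives the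
  -- majorant M |v^(β-1)|.
  set c := (y + b) / 2 with hc
  have hcb : c < b := by rw [hc]; linarith [hy.2]
  have hyc : y < c := by rw [hc]; linarith [hy.2]
  obtain ⟨M, hM⟩ := (isCompact_Icc (a := (0 : ℝ)) (b := c)).exists_bound_of_continuousOn
    (hf'.mono fun u hu => ⟨by linarith [hu.1], by linarith [hu.2]⟩)
  have hsub : ∀ {z : ℝ}, z ∈ Set.Ioo 0 c → z ∈ Set.Ioo 0 b := fun hz => ⟨hz.1, hz.2.trans hcb⟩
  have hcomp : ∀ z ∈ Set.Ioo 0 b, ContinuousOn (fun v : ℝ => f (z * (1 - v))) (Set.Icc 0 1) :=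
    fun z hz => hfc.comp (by fun_prop) (hmaps z hz)
  have hcomp' : ContinuousOn (fun v : ℝ => ((1 - v : ℝ) : ℂ) * f' (y * (1 - v))) (Set.Icc 0 1) :=
    ContinuousOn.mul (by fun_prop) (hf'.comp (by fun_prop) (hmaps y hy))
  have hcpow := intervalIntegrable_mul_cpow hβ (h := fun _ => (M : ℂ)) continuousOn_const
  refine (intervalIntegral.hasDerivAt_integral_of_dominated_loc_of_deriv_le
    (F := fun y v => f (y * (1 - v)) * (v : ℂ) ^ (β - 1))
    (F' := fun y v => ((1 - v : ℝ) : ℂ) * f' (y * (1 - v)) * (v : ℂ) ^ (β - 1))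
    (s := Set.Ioo 0 c) (bound := fun v => ‖(M : ℂ) * (v : ℂ) ^ (β - 1)‖)
    (Ioo_mem_nhds hy.1 hyc) ?_ ?_ ?_ ?_ ?_ ?_).2
  · filter_upwards [Ioo_mem_nhds hy.1 hyc] with z hz
    exact (intervalIntegrable_mul_cpow hβ (hcomp z (hsub hz))).def'.aestronglyMeasurable
  · exact intervalIntegrable_mul_cpow hβ (hcomp y hy)
  · exact (intervalIntegrable_mul_cpow hβ hcomp').def'.aestronglyMeasurable
  · refine Eventually.of_forall fun v hv z hz => ?_
    rw [Set.uIoc_of_le zero_le_one] at hv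
    rw [norm_mul, norm_mul, norm_mul]
    gcongr
    have h1 : z * (1 - v) ≤ z := mul_le_of_le_one_right hz.1.le (by linarith [hv.1])
    have h2 : 0 ≤ z * (1 - v) := mul_nonneg hz.1.le (by linarith [hv.2])
    have h3 := hM _ ⟨h2, h1.trans hz.2.le⟩
    have hM0 : 0 ≤ M := (norm_nonneg _).trans h3
    rw [Complex.norm_real, Complex.norm_real, Real.norm_eq_abs, Real.norm_eq_abs,
      abs_of_nonneg hM0, abs_of_nonneg (by linarith [hv.2])]
    calc (1 - v) * ‖f' (z * (1 - v))‖ ≤ 1 * M := by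
          gcongr
          linarith [hv.1]
      _ = M := one_mul M
  · exact hcpow.norm
  · refine Eventually.of_forall fun v hv z hz => ?_
    rw [Set.uIoc_of_le zero_le_one] at hv
    have h1 : HasDerivAt (fun z : ℝ => z * (1 - v)) (1 - v) z := by
      simpa using (hasDerivAt_id z).mul_const (1 - v)
    have h2 := (hf _ (hmaps z (hsub hz) ⟨hv.1.le, hv.2⟩)).scomp z h1
    have h3 := h2.mul_const ((v : ℂ) ^ (β - 1))
    refine h3.congr_deriv ?_
    rw [Complex.real_smul]

/-- Integrate β v^(β-1) to v^β: the boundary value at v = 1 is f 0, the one at v = 0 vanishes as Re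
β > 0. Then v · v^(β-1) + (1 - v) v^(β-1) = v^(β-1) combines the two integrals of f'. -/
theorem scaledIntegral_by_parts {β : ℂ} (hβ : 0 < β.re) {f f' : ℝ → ℂ} {η b : ℝ} (hη : 0 < η)
    (hf : ∀ u ∈ Set.Ioo (-η) b, HasDerivAt f (f' u) u) (hf' : ContinuousOn f' (Set.Ioo (-η) b))
    {y : ℝ} (hy : y ∈ Set.Ioo 0 b) :
    β * scaledIntegral β f y + y * ∫ v in (0 : ℝ)..1,
      ((1 - v : ℝ) : ℂ) * f' (y * (1 - v)) * (v : ℂ) ^ (β - 1) =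
        f 0 + y * scaledIntegral β f' y := by
  have hβ0 : β ≠ 0 := by
    rintro rfl
    simp at hβ
  have hfc : ContinuousOn f (Set.Ioo (-η) b) := fun u hu => (hf u hu).continuousAt.continuousWithinAt
  have hmaps : Set.MapsTo (fun v : ℝ => y * (1 - v)) (Set.Icc 0 1)
      (Set.Ioo (-η) b) := fun v hv => mul_one_sub_mem hη hy hv
  have hcf : ContinuousOn (fun v : ℝ => f (y * (1 - v))) (Set.Icc 0 1) :=
    hfc.comp (by fun_prop) hmaps
  have hcf' : ContinuousOn (fun v : ℝ => f' (y * (1 - v))) (Set.Icc 0 1) :=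
    hf'.comp (by fun_prop) hmaps
  have hpowc : ContinuousOn (fun v : ℝ => (v : ℂ) ^ β) (Set.Icc 0 1) := by
    have : Continuous fun v : ℝ => (v : ℂ) ^ β := Complex.continuous_ofReal_cpow_const hβ
    exact this.continuousOn
  have hparts := intervalIntegral.integral_mul_deriv_eq_deriv_mul_of_hasDerivAt (a := 0) (b := 1)
    (u := fun v : ℝ => f (y * (1 - v))) (v := fun v : ℝ => (v : ℂ) ^ β)
    (u' := fun v : ℝ => -(y : ℂ) * f' (y * (1 - v))) (v' := fun v : ℝ => β * (v : ℂ) ^ (β - 1))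
    (by rwa [Set.uIcc_of_le zero_le_one]) (by rwa [Set.uIcc_of_le zero_le_one])
    (fun v hv => ?_) (fun v hv => ?_) ?_ ?_
  · have e1 : ∫ v in (0 : ℝ)..1, f (y * (1 - v)) * (β * (v : ℂ) ^ (β - 1)) =
        β * scaledIntegral β f y := by
      rw [scaledIntegral, ← intervalIntegral.integral_const_mul]
      congr 1
      funext v
      ring
    have e2 : ∫ v in (0 : ℝ)..1, -(y : ℂ) * f' (y * (1 - v)) * (v : ℂ) ^ β =
        -(y : ℂ) * ∫ v in (0 : ℝ)..1, f' (y * (1 - v)) * (v : ℂ) ^ β := by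
      rw [← intervalIntegral.integral_const_mul]
      congr 1
      funext v
      ring
    have e3 : (∫ v in (0 : ℝ)..1, f' (y * (1 - v)) * (v : ℂ) ^ β) + ∫ v in (0 : ℝ)..1,
        ((1 - v : ℝ) : ℂ) * f' (y * (1 - v)) * (v : ℂ) ^ (β - 1) = scaledIntegral β f' y := by
      rw [← intervalIntegral.integral_add, scaledIntegral]
      · rw [intervalIntegral.integral_of_le zero_le_one, intervalIntegral.integral_of_le zero_le_one]
        refine MeasureTheory.setIntegral_congr_fun measurableSet_Ioc fun v hv => ?_
        have hv0 : (v : ℂ) ≠ 0 := by exact_mod_cast hv.1.ne'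
        rw [Complex.cpow_sub _ _ hv0, Complex.cpow_one]
        push_cast
        field_simp
        ring
      · refine ContinuousOn.intervalIntegrable ?_
        rw [Set.uIcc_of_le zero_le_one]
        exact hcf'.mul hpowc
      · exact intervalIntegrable_mul_cpow hβ (ContinuousOn.mul (by fun_prop) hcf')
    rw [e1, e2] at hparts
    rw [hparts, ← e3]
    simp [Complex.zero_cpow hβ0]
    ring
  · rw [min_eq_left zero_le_one, max_eq_right zero_le_one] at hv
    have h1 : HasDerivAt (fun v : ℝ => y * (1 - v)) (-y) v := by
      simpa using ((hasDerivAt_id v).const_sub 1).const_mul y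
    refine ((hf _ (hmaps ⟨hv.1.le, hv.2.le⟩)).scomp v h1).congr_deriv ?_
    rw [Complex.real_smul]
    simp
  · rw [min_eq_left zero_le_one, max_eq_right zero_le_one] at hv
    have h1 : HasDerivAt (fun z : ℂ => z ^ β) (β * (v : ℂ) ^ (β - 1) * 1) (v : ℂ) :=
      (hasDerivAt_id' (v : ℂ)).cpow_const (Complex.ofReal_mem_slitPlane.2 hv.1)
    simpa using h1.comp_ofReal
  · refine ContinuousOn.intervalIntegrable ?_
    rw [Set.uIcc_of_le zero_le_one]
    exact continuousOn_const.mul hcf'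
  · exact intervalIntegrable_mul_cpow hβ (h := fun _ => β) continuousOn_const

theorem hasDerivAt_ofReal_cpow {y : ℝ} (hy : 0 < y) (γ : ℂ) :
    HasDerivAt (fun y : ℝ => (y : ℂ) ^ γ) (γ * (y : ℂ) ^ (γ - 1)) y := by
  have h1 : HasDerivAt (fun z : ℂ => z ^ γ) (γ * (y : ℂ) ^ (γ - 1) * 1) (y : ℂ) :=
    (hasDerivAt_id' (y : ℂ)).cpow_const (Complex.ofReal_mem_slitPlane.2 hy)
  simpa using h1.comp_ofReal

theorem hasDerivAt_rlIntegral {β : ℂ} (hβ : 0 < β.re) {f f' : ℝ → ℂ} {η b : ℝ} (hη : 0 < η)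
    (hf : ∀ u ∈ Set.Ioo (-η) b, HasDerivAt f (f' u) u) (hf' : ContinuousOn f' (Set.Ioo (-η) b))
    {y : ℝ} (hy : y ∈ Set.Ioo 0 b) :
    HasDerivAt (rlIntegral β f)
      (f 0 * (y : ℂ) ^ (β - 1) / Complex.Gamma β + rlIntegral β f' y) y := by
  have hyc : (y : ℂ) ≠ 0 := by exact_mod_cast hy.1.ne'
  have h1 := ((hasDerivAt_ofReal_cpow hy.1 β).div_const (Complex.Gamma β)).mul
    (hasDerivAt_scaledIntegral hβ hη hf hf' hy)
  have h2 : rlIntegral β f =ᶠ[𝓝 y]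
      (fun y : ℝ => (y : ℂ) ^ β / Complex.Gamma β) * scaledIntegral β f := by
    filter_upwards [lt_mem_nhds hy.1] with z hz
    exact rlIntegral_eq_scaledIntegral hβ f hz
  refine (h1.congr_of_eventuallyEq h2).congr_deriv ?_
  have h3 := scaledIntegral_by_parts hβ hη hf hf' hy
  rw [rlIntegral_eq_scaledIntegral hβ f' hy.1]
  have h4 : (y : ℂ) ^ β = (y : ℂ) ^ (β - 1) * y := by
    rw [Complex.cpow_sub _ _ hyc, Complex.cpow_one]
    field_simp
  rw [h4]
  linear_combination ((y : ℂ) ^ (β - 1) / Complex.Gamma β) * h3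

/-- The `m`-th derivative of `₀I^β g_0`, when `g_k` is the `k`-th derivative of `g_0`. -/
noncomputable def rlIntegralDeriv (β : ℂ) (g : ℕ → ℝ → ℂ) (m : ℕ) (y : ℝ) : ℂ :=
  ∑ j ∈ Finset.range m, g j 0 * ((y : ℂ) ^ (β - m + j) / Complex.Gamma (β - m + j + 1)) +
    rlIntegral β (g m) y

theorem hasDerivAt_rlIntegralDeriv {β : ℂ} (hβ : 0 < β.re) {g : ℕ → ℝ → ℂ} {η b : ℝ} (hη : 0 < η)
    (hg : ∀ u ∈ Set.Ioo (-η) b, ∀ k, HasDerivAt (g k) (g (k + 1) u) u) {y : ℝ}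
    (hy : y ∈ Set.Ioo 0 b) (m : ℕ) :
    HasDerivAt (rlIntegralDeriv β g m) (rlIntegralDeriv β g (m + 1) y) y := by
  have h1 := hasDerivAt_rlIntegral hβ hη (fun u hu => hg u hu m)
    (fun u hu => (hg u hu (m + 1)).continuousAt.continuousWithinAt) hy
  have h2 : ∀ j ∈ Finset.range m, HasDerivAt
      (fun y : ℝ => g j 0 * ((y : ℂ) ^ (β - m + j) / Complex.Gamma (β - m + j + 1)))
      (g j 0 * ((y : ℂ) ^ (β - (m + 1 : ℕ) + j) / Complex.Gamma (β - (m + 1 : ℕ) + j + 1))) y := by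
    intro j _
    refine (((hasDerivAt_ofReal_cpow hy.1 _).div_const _).const_mul _).congr_deriv ?_
    have e1 : β - ((m + 1 : ℕ) : ℂ) + j + 1 = β - m + j := by push_cast; ring
    have e2 : β - ((m + 1 : ℕ) : ℂ) + j = β - m + j - 1 := by push_cast; ring
    -- 1/Γ(s) = s/Γ(s + 1) holds for every s, also at the poles, so no exponent has to be excluded.
    rw [e1, e2, div_eq_mul_inv _ (Complex.Gamma (β - m + j)),
      Complex.one_div_Gamma_eq_self_mul_one_div_Gamma_add_one]
    ring
  have h3 := (HasDerivAt.fun_sum h2).add h1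
  refine h3.congr_deriv ?_
  rw [rlIntegralDeriv, Finset.sum_range_succ]
  have e1 : β - ((m + 1 : ℕ) : ℂ) + m + 1 = β := by push_cast; ring
  have e2 : β - ((m + 1 : ℕ) : ℂ) + m = β - 1 := by push_cast; ring
  rw [e1, e2]
  ring

theorem iteratedDeriv_rlIntegral {β : ℂ} (hβ : 0 < β.re) {g : ℕ → ℝ → ℂ} {η b : ℝ} (hη : 0 < η)
    (hg : ∀ u ∈ Set.Ioo (-η) b, ∀ k, HasDerivAt (g k) (g (k + 1) u) u) {y : ℝ}
    (hy : y ∈ Set.Ioo 0 b) (n : ℕ) :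
    ContDiffAt ℝ n (rlIntegral β (g 0)) y ∧
      iteratedDeriv n (rlIntegral β (g 0)) y = rlIntegralDeriv β g n y := by
  have h0 : rlIntegralDeriv β g 0 = rlIntegral β (g 0) := by
    funext y
    simp [rlIntegralDeriv]
  have hF : ∀ u ∈ Set.Ioo 0 b, ∀ k,
      HasDerivAt (rlIntegralDeriv β g k) (rlIntegralDeriv β g (k + 1) u) u :=
    fun u hu k => hasDerivAt_rlIntegralDeriv hβ hη hg hu k
  rw [← h0]
  exact ⟨(contDiffOn_of_hasDerivAt isOpen_Ioo hF n 0).contDiffAt (isOpen_Ioo.mem_nhds hy),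
    eqOn_iteratedDeriv_of_hasDerivAt isOpen_Ioo hF n hy⟩

/-! ### Power series in the unit disc and Abel summation. -/

/-- The power series with coefficients `D` converges absolutely in the open unit disc. -/
def UnitDiscSummable (D : ℕ → ℂ) : Prop :=
  ∀ q : ℝ, 0 ≤ q → q < 1 → Summable fun k => ‖D k‖ * q ^ k

theorem UnitDiscSummable.hasSum {D : ℕ → ℂ} (hD : UnitDiscSummable D) {z : ℂ} (hz : ‖z‖ < 1) :
    HasSum (fun k => D k * z ^ k) (∑' k, D k * z ^ k) := by
  refine Summable.hasSum (Summable.of_norm ?_)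
  simpa only [norm_mul, norm_pow] using hD ‖z‖ (norm_nonneg z) hz

theorem UnitDiscSummable.of_norm_le {D E : ℕ → ℂ} (hD : UnitDiscSummable D) {C : ℝ}
    (h : ∀ k, ‖E k‖ ≤ C * ‖D k‖) : UnitDiscSummable E := by
  intro q hq0 hq1
  refine Summable.of_nonneg_of_le (fun k => by positivity) (fun k => ?_)
    ((hD q hq0 hq1).mul_left C)
  rw [← mul_assoc]
  gcongr
  exact h k

theorem unitDiscSummable_of_norm_le {D : ℕ → ℂ} {C : ℝ} (h : ∀ k : ℕ, ‖D k‖ ≤ C * (k + 1)) :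
    UnitDiscSummable D := by
  intro q hq0 hq1
  have h1 := summable_pow_mul_geometric_of_norm_lt_one 1 (r := q)
    (by rwa [Real.norm_eq_abs, abs_of_nonneg hq0])
  have h2 := summable_geometric_of_lt_one hq0 hq1
  refine Summable.of_nonneg_of_le (fun k => by positivity) (fun k => ?_) ((h1.add h2).mul_left C)
  calc ‖D k‖ * q ^ k ≤ C * (k + 1) * q ^ k := by gcongr; exact h k
    _ = _ := by ring

theorem tendsto_inv_natCast_add (γ : ℂ) : Tendsto (fun k : ℕ => ((k : ℂ) + γ)⁻¹) atTop (𝓝 0) := by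
  refine tendsto_inv₀_cobounded.comp ?_
  rw [← tendsto_norm_atTop_iff_cobounded]
  refine tendsto_atTop_mono (f := fun k : ℕ => (k : ℝ) - ‖γ‖) (fun k => ?_) ?_
  · have := norm_sub_norm_le (k : ℂ) (-γ)
    rwa [norm_neg, sub_neg_eq_add, Complex.norm_natCast] at this
  · exact tendsto_atTop_add_const_right _ _ tendsto_natCast_atTop_atTop

theorem UnitDiscSummable.div_add {D : ℕ → ℂ} (hD : UnitDiscSummable D) (γ : ℂ) :
    UnitDiscSummable fun k => D k / (k + γ) := by
  obtain ⟨C, hC⟩ := (tendsto_inv_natCast_add γ).norm.bddAbove_range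
  refine hD.of_norm_le (C := C) fun k => ?_
  rw [div_eq_mul_inv, norm_mul, mul_comm]
  gcongr
  exact hC ⟨k, rfl⟩

theorem UnitDiscSummable.norm_le_of_mem_ball {D : ℕ → ℂ} {q : ℝ} {k : ℕ} {w : ℂ}
    (hw : w ∈ Metric.ball (0 : ℂ) q) : ‖D k * w ^ k‖ ≤ ‖D k‖ * q ^ k := by
  rw [norm_mul, norm_pow]
  gcongr
  exact (mem_ball_zero_iff.1 hw).le

theorem UnitDiscSummable.differentiableOn {D : ℕ → ℂ} (hD : UnitDiscSummable D) :
    DifferentiableOn ℂ (fun z => ∑' k, D k * z ^ k) (Metric.ball 0 1) := by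
  intro z hz
  rw [mem_ball_zero_iff] at hz
  obtain ⟨q, hzq, hq1⟩ := exists_between hz
  have h := Complex.differentiableOn_tsum_of_summable_norm
    (F := fun k (z : ℂ) => D k * z ^ k) (U := Metric.ball 0 q)
    (hD q ((norm_nonneg z).trans hzq.le) hq1) (fun k => by fun_prop) Metric.isOpen_ball
    (fun k w hw => UnitDiscSummable.norm_le_of_mem_ball hw)
  exact (h.differentiableAt (Metric.isOpen_ball.mem_nhds
    (mem_ball_zero_iff.2 hzq))).differentiableWithinAt

theorem UnitDiscSummable.hasDerivAt {D : ℕ → ℂ} (hD : UnitDiscSummable D) {z : ℂ} (hz : ‖z‖ < 1) :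
    HasDerivAt (fun z => ∑' k, D k * z ^ k) (deriv (fun z => ∑' k, D k * z ^ k) z) z :=
  (hD.differentiableOn.differentiableAt
    (Metric.isOpen_ball.mem_nhds (mem_ball_zero_iff.2 hz))).hasDerivAt

theorem UnitDiscSummable.hasSum_deriv {D : ℕ → ℂ} (hD : UnitDiscSummable D) {z : ℂ}
    (hz : ‖z‖ < 1) :
    HasSum (fun k : ℕ => ((k : ℂ) + 1) * D (k + 1) * z ^ k)
      (deriv (fun z => ∑' k, D k * z ^ k) z) := by
  obtain ⟨q, hzq, hq1⟩ := exists_between hz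
  have h := Complex.hasSum_deriv_of_summable_norm
    (F := fun k (z : ℂ) => D k * z ^ k) (U := Metric.ball 0 q)
    (hD q ((norm_nonneg z).trans hzq.le) hq1) (fun k => by fun_prop) Metric.isOpen_ball
    (fun k w hw => UnitDiscSummable.norm_le_of_mem_ball hw) (mem_ball_zero_iff.2 hzq)
  rw [← hasSum_nat_add_iff' 1] at h
  simp only [Finset.sum_range_one, pow_zero, mul_one, deriv_const, sub_zero] at h
  refine h.congr_fun fun k => ?_
  rw [deriv_const_mul_field, deriv_pow_field]
  push_cast
  ring

/-- Summability in ℂ is absolute, so convergence of the differentiated series at the real point q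
suffices. -/
theorem UnitDiscSummable.shift {D : ℕ → ℂ} (hD : UnitDiscSummable D) :
    UnitDiscSummable fun k => ((k : ℂ) + 1) * D (k + 1) := by
  intro q hq0 hq1
  have h := (hD.hasSum_deriv (z := (q : ℂ))
    (by rwa [Complex.norm_real, Real.norm_eq_abs, abs_of_nonneg hq0])).summable.norm
  refine h.congr fun k => ?_
  rw [norm_mul, norm_pow, Complex.norm_real, Real.norm_eq_abs, abs_of_nonneg hq0]

theorem ofReal_tendsto_one : Tendsto (fun s : ℝ => (s : ℂ)) (𝓝[<] 1) (𝓝 1) := by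
  have : Tendsto (fun r : ℝ => (r : ℂ)) (𝓝 1) (𝓝 ((1 : ℝ) : ℂ)) :=
    Complex.continuous_ofReal.tendsto 1
  simpa using this.mono_left nhdsWithin_le_nhds

theorem norm_ofReal_lt_one {s : ℝ} (hs : s ∈ Set.Ioo (0 : ℝ) 1) : ‖(s : ℂ)‖ < 1 := by
  rw [Complex.norm_real, Real.norm_eq_abs, abs_of_pos hs.1]
  exact hs.2

/-- Termwise integration of a power series against `v^(β - 1)`. -/
theorem tsum_div_eq_integral {β : ℂ} (hβ : 0 < β.re) {D : ℕ → ℂ} (hD : UnitDiscSummable D)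
    {h : ℝ → ℂ} (hh : ∀ v ∈ Set.Ioo (0 : ℝ) 1, HasSum (fun k => D k * (v : ℂ) ^ k) (h v))
    {s : ℝ} (hs : s ∈ Set.Ioo (0 : ℝ) 1) :
    ∑' k, D k / (k + β) * (s : ℂ) ^ k = ∫ v in (0 : ℝ)..1, h (s * v) * (v : ℂ) ^ (β - 1) := by
  have hpow : IntervalIntegrable (fun v : ℝ => (v : ℂ) ^ (β - 1)) MeasureTheory.volume 0 1 :=
    intervalIntegral.intervalIntegrable_cpow' (by simpa using hβ)
  have hsum := hD s hs.1.le hs.2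
  have key := intervalIntegral.hasSum_integral_of_dominated_convergence (a := 0) (b := 1)
    (μ := MeasureTheory.volume)
    (F := fun (k : ℕ) (v : ℝ) => D k * (s : ℂ) ^ k * ((v : ℂ) ^ k * (v : ℂ) ^ (β - 1)))
    (f := fun v => h (s * v) * (v : ℂ) ^ (β - 1))
    (fun k v => ‖D k‖ * s ^ k * ‖(v : ℂ) ^ (β - 1)‖) (fun k => ?_) (fun k => ?_) ?_ ?_ ?_
  · rw [← key.tsum_eq]
    refine tsum_congr fun k => ?_
    rw [intervalIntegral.integral_const_mul]
    have h1 : ∫ v in (0 : ℝ)..1, (v : ℂ) ^ k * (v : ℂ) ^ (β - 1) = 1 / (k + β) := by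
      have h2 : ∫ v in (0 : ℝ)..1, (v : ℂ) ^ k * (v : ℂ) ^ (β - 1) =
          ∫ v in (0 : ℝ)..1, (v : ℂ) ^ ((k : ℂ) + β - 1) := by
        rw [intervalIntegral.integral_of_le zero_le_one, intervalIntegral.integral_of_le zero_le_one]
        refine MeasureTheory.setIntegral_congr_fun measurableSet_Ioc fun v hv => ?_
        have hv0 : (v : ℂ) ≠ 0 := by exact_mod_cast hv.1.ne'
        rw [add_sub_assoc, Complex.cpow_add _ _ hv0, Complex.cpow_natCast]
      have hre : 0 < ((k : ℂ) + β).re := by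
        simp only [Complex.add_re, Complex.natCast_re]
        positivity
      have hne : (k : ℂ) + β ≠ 0 := by
        intro h0
        simp [h0] at hre
      rw [h2, integral_cpow (Or.inl (by simp only [Complex.sub_re, Complex.one_re]; linarith))]
      rw [sub_add_cancel, Complex.ofReal_one, Complex.one_cpow, Complex.ofReal_zero,
        Complex.zero_cpow hne, sub_zero]
    rw [h1]
    ring
  · refine MeasureTheory.AEStronglyMeasurable.const_mul ?_ _
    refine MeasureTheory.AEStronglyMeasurable.mul ?_ hpow.def'.aestronglyMeasurable
    exact Continuous.aestronglyMeasurable (by fun_prop)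
  · refine Eventually.of_forall fun v hv => ?_
    rw [Set.uIoc_of_le zero_le_one] at hv
    rw [norm_mul, norm_mul, norm_mul, norm_pow, norm_pow, Complex.norm_real, Complex.norm_real,
      Real.norm_eq_abs, Real.norm_eq_abs, abs_of_pos hs.1, abs_of_pos hv.1]
    gcongr
    · have := hs.1
      positivity
    · exact mul_le_of_le_one_left (norm_nonneg _) (pow_le_one₀ hv.1.le hv.2)
  · exact Eventually.of_forall fun v _ => hsum.mul_right _
  · simp only [tsum_mul_right]
    exact hpow.norm.const_mul _
  · refine Eventually.of_forall fun v hv => ?_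
    rw [Set.uIoc_of_le zero_le_one] at hv
    have hsv : s * v ∈ Set.Ioo (0 : ℝ) 1 :=
      ⟨mul_pos hs.1 hv.1, (mul_le_of_le_one_right hs.1.le hv.2).trans_lt hs.2⟩
    refine ((hh _ hsv).mul_right ((v : ℂ) ^ (β - 1))).congr_fun fun k => ?_
    rw [Complex.ofReal_mul, mul_pow]
    ring

/-- Abel summation of the series of the fractional derivative, with base point at `v = 1`. -/
theorem tendsto_abel_rlIntegralDeriv {β : ℂ} (hβ : 0 < β.re) {η b x : ℝ} (hη : 0 < η)
    (hx : x ∈ Set.Ioo 0 b) (n : ℕ) : ∀ {g : ℕ → ℝ → ℂ} {D : ℕ → ℂ},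
    (∀ u ∈ Set.Ioo (-η) b, ∀ k, HasDerivAt (g k) (g (k + 1) u) u) → UnitDiscSummable D →
    (∀ v ∈ Set.Ioo (0 : ℝ) 1, HasSum (fun k => D k * (v : ℂ) ^ k) (g 0 (x * (1 - v)))) →
    (∀ k : ℕ, (k : ℂ) + (β - n) ≠ 0) →
    Tendsto (fun s : ℝ => (x : ℂ) ^ (β - n) / Complex.Gamma (β - n) *
      ∑' k, D k / (k + (β - n)) * (s : ℂ) ^ k) (𝓝[<] 1) (𝓝 (rlIntegralDeriv β g n x)) := by
  have hxc : (x : ℂ) ≠ 0 := by exact_mod_cast hx.1.ne'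
  have hmem : ∀ᶠ s : ℝ in 𝓝[<] 1, s ∈ Set.Ioo (0 : ℝ) 1 := Ioo_mem_nhdsLT one_pos
  induction n with
  | zero =>
    intro g D hg hD hsum _
    have h0 : rlIntegralDeriv β g 0 x =
        (x : ℂ) ^ β / Complex.Gamma β * scaledIntegral β (g 0) x := by
      rw [← rlIntegral_eq_scaledIntegral hβ _ hx.1]
      simp [rlIntegralDeriv]
    simp only [Nat.cast_zero, sub_zero]
    rw [h0]
    refine Tendsto.const_mul _ ?_
    have hlim : Tendsto (fun s : ℝ => ∫ v in (0 : ℝ)..1,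
        g 0 (x * (1 - s * v)) * (v : ℂ) ^ (β - 1)) (𝓝[<] 1) (𝓝 (scaledIntegral β (g 0) x)) := by
      have hgc : ContinuousOn (g 0) (Set.Ioo (-η) b) :=
        fun u hu => (hg u hu 0).continuousAt.continuousWithinAt
      have hmaps : ∀ {w : ℝ}, w ∈ Set.Icc (0 : ℝ) 1 → x * (1 - w) ∈ Set.Ioo (-η) b :=
        fun hw => mul_one_sub_mem hη hx hw
      obtain ⟨M, hM⟩ := (isCompact_Icc (a := (0 : ℝ)) (b := x)).exists_bound_of_continuousOn
        (hgc.mono fun u hu => ⟨by linarith [hu.1], by linarith [hu.2, hx.2]⟩)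
      have hpow : IntervalIntegrable (fun v : ℝ => (v : ℂ) ^ (β - 1)) MeasureTheory.volume 0 1 :=
        intervalIntegral.intervalIntegrable_cpow' (by simpa using hβ)
      have hprod : ∀ {s v : ℝ}, s ∈ Set.Ioo (0 : ℝ) 1 → v ∈ Set.Icc (0 : ℝ) 1 →
          s * v ∈ Set.Icc (0 : ℝ) 1 := fun hs hv =>
        ⟨mul_nonneg hs.1.le hv.1, mul_le_one₀ hs.2.le hv.1 hv.2⟩
      refine intervalIntegral.tendsto_integral_filter_of_dominated_convergence
        (fun v => M * ‖(v : ℂ) ^ (β - 1)‖) ?_ ?_ (hpow.norm.const_mul M) ?_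
      · filter_upwards [hmem] with s hs
        exact (intervalIntegrable_mul_cpow hβ (hgc.comp (f := fun v : ℝ => x * (1 - s * v))
          (by fun_prop) fun v hv => hmaps (hprod hs hv))).def'.aestronglyMeasurable
      · filter_upwards [hmem] with s hs
        refine Eventually.of_forall fun v hv => ?_
        rw [Set.uIoc_of_le zero_le_one] at hv
        rw [norm_mul]
        gcongr
        have h1 := hprod hs ⟨hv.1.le, hv.2⟩
        exact hM _ ⟨mul_nonneg hx.1.le (by linarith [h1.2]),
          mul_le_of_le_one_right hx.1.le (by linarith [h1.1])⟩
      · refine Eventually.of_forall fun v hv => ?_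
        rw [Set.uIoc_of_le zero_le_one] at hv
        refine Tendsto.mul_const _ ?_
        have h1 : ContinuousAt (g 0) (x * (1 - v)) := (hg _ (hmaps ⟨hv.1.le, hv.2⟩) 0).continuousAt
        refine h1.tendsto.comp ?_
        have h2 : Continuous fun s : ℝ => x * (1 - s * v) := by fun_prop
        have h3 := h2.tendsto 1
        rw [one_mul] at h3
        exact h3.mono_left nhdsWithin_le_nhds
    refine hlim.congr' ?_
    filter_upwards [hmem] with s hs
    exact (tsum_div_eq_integral hβ hD (h := fun v => g 0 (x * (1 - v))) hsum hs).symm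
  | succ n ih =>
    intro g D hg hD hsum hne
    -- As γ/(k + γ) = 1 - k/(k + γ), γ times the series is g 0 (x(1 - s)) minus ∑ k D_k s^k / (k +
    -- γ). The former tends to the boundary term at 0; the latter, reindexed, is the series of g 1
    -- with exponent γ + 1 = β - n, to which induction applies.
    set γ : ℂ := β - (n + 1 : ℕ) with hγ
    have hγ1 : β - n = γ + 1 := by rw [hγ]; push_cast; ring
    have hγ0 : γ ≠ 0 := by simpa using hne 0
    have hφ : ∀ v ∈ Set.Ioo (0 : ℝ) 1, deriv (fun z : ℂ => ∑' k, D k * z ^ k) v =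
        -(x : ℂ) * g 1 (x * (1 - v)) := by
      intro v hv
      have h1 := (hD.hasDerivAt (norm_ofReal_lt_one hv)).comp_ofReal
      have h2 : HasDerivAt (fun v : ℝ => x * (1 - v)) (-x) v := by
        simpa using ((hasDerivAt_id v).const_sub 1).const_mul x
      have h3 := (hg _ (mul_one_sub_mem hη hx ⟨hv.1.le, hv.2.le⟩) 0).scomp v h2
      have h4 : (fun v : ℝ => ∑' k, D k * (v : ℂ) ^ k) =ᶠ[𝓝 v] g 0 ∘ fun v => x * (1 - v) := by
        filter_upwards [Ioo_mem_nhds hv.1 hv.2] with w hw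
        exact (hsum w hw).tsum_eq
      have h5 := h1.unique (h3.congr_of_eventuallyEq h4)
      rw [h5, Complex.real_smul]
      simp
    have hD' : UnitDiscSummable fun k => -(x : ℂ)⁻¹ * (((k : ℂ) + 1) * D (k + 1)) :=
      hD.shift.of_norm_le (C := ‖-(x : ℂ)⁻¹‖) fun k => by rw [norm_mul]
    have h1 := ih (g := fun k => g (k + 1)) (fun u hu k => hg u hu (k + 1)) hD'
      (fun v hv => by
        have h2 := (hD.hasSum_deriv (norm_ofReal_lt_one hv)).mul_left (-(x : ℂ)⁻¹)
        rw [hφ v hv] at h2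
        have h3 : -(x : ℂ)⁻¹ * (-(x : ℂ) * g 1 (x * (1 - v))) = g (0 + 1) (x * (1 - v)) := by
          field_simp
        rw [h3] at h2
        refine h2.congr_fun fun k => ?_
        ring)
      (fun k => by
        have := hne (k + 1)
        rw [hγ1]
        push_cast at this
        convert! this using 1
        ring)
    have h2 : Tendsto (fun s : ℝ => (x : ℂ) ^ γ / Complex.Gamma (γ + 1) * g 0 (x * (1 - s)))
        (𝓝[<] 1) (𝓝 ((x : ℂ) ^ γ / Complex.Gamma (γ + 1) * g 0 0)) := by
      refine Tendsto.const_mul _ ?_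
      have h0 : ContinuousAt (g 0) 0 := (hg 0 ⟨by linarith, hx.1.trans hx.2⟩ 0).continuousAt
      refine h0.tendsto.comp ?_
      have h3 : Continuous fun s : ℝ => x * (1 - s) := by fun_prop
      have h4 := h3.tendsto 1
      rw [sub_self, mul_zero] at h4
      exact h4.mono_left nhdsWithin_le_nhds
    have h3 := h2.add (ofReal_tendsto_one.mul h1)
    have hval : rlIntegralDeriv β g (n + 1) x = (x : ℂ) ^ γ / Complex.Gamma (γ + 1) * g 0 0 +
        1 * rlIntegralDeriv β (fun k => g (k + 1)) n x := by
      rw [rlIntegralDeriv, rlIntegralDeriv, Finset.sum_range_succ']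
      have e : ∀ j : ℕ, γ + ((j + 1 : ℕ) : ℂ) = β - n + j := by
        intro j
        rw [hγ]
        push_cast
        ring
      simp only [← hγ, e, Nat.cast_zero, add_zero]
      ring
    rw [hval]
    refine h3.congr' ?_
    filter_upwards [hmem] with s hs
    have hsn := norm_ofReal_lt_one hs
    have hA := hsum s hs
    have hB : HasSum (fun k : ℕ => (k : ℂ) * D k / (k + γ) * (s : ℂ) ^ k)
        (-(x : ℂ) * (s * ∑' k : ℕ, -(x : ℂ)⁻¹ * (((k : ℂ) + 1) * D (k + 1)) / (k + (β - n)) *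
          (s : ℂ) ^ k)) := by
      rw [← hasSum_nat_add_iff' 1]
      simp only [Finset.sum_range_one, Nat.cast_zero, zero_mul, zero_div, sub_zero]
      refine ((((hD'.div_add (β - n)).hasSum hsn).mul_left (s : ℂ)).mul_left (-(x : ℂ))).congr_fun
        fun k => ?_
      have h5 : ((k + 1 : ℕ) : ℂ) + γ = k + (β - n) := by rw [hγ1]; push_cast; ring
      rw [h5, pow_succ]
      push_cast
      field_simp
    have hC : HasSum (fun k : ℕ => γ * (D k / (k + γ) * (s : ℂ) ^ k))
        (g 0 (x * (1 - s)) - (-(x : ℂ) * (s * ∑' k : ℕ, -(x : ℂ)⁻¹ *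
          (((k : ℂ) + 1) * D (k + 1)) / (k + (β - n)) * (s : ℂ) ^ k))) := by
      refine (hA.sub hB).congr_fun fun k => ?_
      have := hne k
      field_simp
      ring
    have hE := hC.tsum_eq
    rw [tsum_mul_left] at hE
    rw [hγ1] at hE ⊢
    have hx1 : (x : ℂ) ^ (γ + 1) = (x : ℂ) ^ γ * x := by
      rw [Complex.cpow_add _ _ hxc, Complex.cpow_one]
    have hG : (x : ℂ) ^ γ / Complex.Gamma γ = (x : ℂ) ^ γ / Complex.Gamma (γ + 1) * γ := by
      rw [Complex.Gamma_add_one _ hγ0]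
      field_simp
    rw [hG, mul_assoc, hE, hx1]
    ring

/-! ### Analytic continuation of the Taylor series at x across the point corresponding to 0. -/

section

open scoped Nat

/-- If `∑ D_k z^k` is regular at `1`, then so is `∑ D_k z^k / (k + γ)`. -/
theorem exists_analyticAt_one_div_add {D : ℕ → ℂ} (hD : UnitDiscSummable D) {γ : ℂ}
    (hγ : ∀ k : ℕ, (k : ℂ) + γ ≠ 0) {Φ : ℂ → ℂ} (hΦ : AnalyticAt ℂ Φ 1)
    (heq : ∀ᶠ z in 𝓝 (1 : ℂ), ‖z‖ < 1 → Φ z = ∑' k, D k * z ^ k) :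
    ∃ G : ℂ → ℂ, AnalyticAt ℂ G 1 ∧ ∀ᶠ z in 𝓝 (1 : ℂ), ‖z‖ < 1 →
      HasSum (fun k => D k / (k + γ) * z ^ k) (G z) := by
  obtain ⟨δ₀, hδ₀, hball₀⟩ := Metric.mem_nhds_iff.1 (heq.and hΦ.eventually_analyticAt)
  set δ := min δ₀ 1 with hδ
  have hδpos : 0 < δ := by positivity
  have hball : ∀ z ∈ Metric.ball (1 : ℂ) δ, (‖z‖ < 1 → Φ z = ∑' k, D k * z ^ k) ∧
      AnalyticAt ℂ Φ z := fun z hz => hball₀ (Metric.ball_subset_ball (min_le_left _ _) hz)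
  have hslit : ∀ z ∈ Metric.ball (1 : ℂ) δ, z ∈ Complex.slitPlane := fun z hz =>
    Complex.ball_one_subset_slitPlane (Metric.ball_subset_ball (min_le_right _ _) hz)
  have hcpow : ∀ (c : ℂ), ∀ z ∈ Metric.ball (1 : ℂ) δ,
      HasDerivAt (fun z : ℂ => z ^ c) (c * z ^ (c - 1)) z := fun c z hz => by
    simpa using (hasDerivAt_id' z).cpow_const (c := c) (hslit z hz)
  -- The sum G of D_k z^k / (k + γ) satisfies z G' + γ G = Φ, that is (z^γ G)' = Φ z^(γ-1). The
  -- right side has a primitive W on the whole disc around 1, so z^(-γ) (W + c) continues G.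
  obtain ⟨W, hW⟩ := DifferentiableOn.isExactOn_ball (c := 1) (r := δ)
    (f := fun z => Φ z * z ^ (γ - 1)) fun z hz =>
      ((hball z hz).2.differentiableAt.mul (hcpow _ z hz).differentiableAt).differentiableWithinAt
  have hE := hD.div_add γ
  set G₀ : ℂ → ℂ := fun z => ∑' k : ℕ, D k / (k + γ) * z ^ k with hG₀
  set V := Metric.ball (0 : ℂ) 1 ∩ Metric.ball 1 δ with hV
  have hVopen : IsOpen V := Metric.isOpen_ball.inter Metric.isOpen_ball
  have hVconv : Convex ℝ V := (convex_ball _ _).inter (convex_ball _ _)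
  have hderiv : ∀ z ∈ V, HasDerivAt (fun z => z ^ γ * G₀ z - W z) 0 z := by
    rintro z ⟨hz0, hz1⟩
    rw [mem_ball_zero_iff] at hz0
    have h1 := ((hcpow γ z hz1).mul (hE.hasDerivAt hz0)).sub (hW z hz1)
    refine h1.congr_deriv ?_
    have hzne : z ≠ 0 := Complex.slitPlane_ne_zero (hslit z hz1)
    have h2 : HasSum (fun k : ℕ => (k : ℂ) * (D k / (k + γ)) * z ^ k) (z * deriv G₀ z) := by
      rw [← hasSum_nat_add_iff' 1]
      simp only [Finset.sum_range_one, Nat.cast_zero, zero_mul, sub_zero]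
      refine ((hE.hasSum_deriv hz0).mul_left z).congr_fun fun k => ?_
      push_cast
      ring
    have h3 : Φ z = γ * G₀ z + z * deriv G₀ z := by
      rw [(hball z hz1).1 hz0, ← (((hE.hasSum hz0).mul_left γ).add h2).tsum_eq]
      refine tsum_congr fun k => ?_
      have := hγ k
      field_simp
      ring
    have h4 : z ^ γ = z ^ (γ - 1) * z := by
      rw [Complex.cpow_sub _ _ hzne, Complex.cpow_one]
      field_simp
    change γ * z ^ (γ - 1) * G₀ z + z ^ γ * deriv G₀ z - Φ z * z ^ (γ - 1) = 0
    rw [h3, h4]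
    ring
  obtain ⟨c, hc⟩ := hVopen.exists_is_const_of_deriv_eq_zero hVconv.isPreconnected
    (fun z hz => (hderiv z hz).differentiableAt.differentiableWithinAt)
    (fun z hz => (hderiv z hz).deriv)
  refine ⟨fun z => z ^ (-γ) * (W z + c), ?_, ?_⟩
  · refine DifferentiableOn.analyticAt (s := Metric.ball 1 δ) (fun z hz => ?_)
      (Metric.ball_mem_nhds 1 hδpos)
    exact ((hcpow _ z hz).differentiableAt.mul
      ((hW z hz).differentiableAt.add_const c)).differentiableWithinAt
  · filter_upwards [Metric.ball_mem_nhds 1 hδpos] with z hz hz1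
    have hzne : z ≠ 0 := Complex.slitPlane_ne_zero (hslit z hz)
    have h1 := hc z ⟨mem_ball_zero_iff.2 hz1, hz⟩
    have h2 : z ^ (-γ) * (W z + c) = G₀ z := by
      rw [← h1, add_sub_cancel, ← mul_assoc, ← Complex.cpow_add _ _ hzne, neg_add_cancel,
        Complex.cpow_zero, one_mul]
    rw [h2]
    exact hE.hasSum hz1

theorem hasDerivAt_iteratedDeriv_of_contDiffOn {f : ℝ → ℂ} {U : Set ℝ} (hU : IsOpen U)
    (hf : ContDiffOn ℝ ∞ f U) : ∀ u ∈ U, ∀ k,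
      HasDerivAt (iteratedDeriv k f) (iteratedDeriv (k + 1) f u) u := by
  intro u hu k
  have h1 : DifferentiableOn ℝ (iteratedDerivWithin k f U) U :=
    hf.differentiableOn_iteratedDerivWithin (by exact_mod_cast ENat.natCast_lt_top k) hU.uniqueDiffOn
  have h2 : iteratedDerivWithin k f U =ᶠ[𝓝 u] iteratedDeriv k f := by
    filter_upwards [hU.mem_nhds hu] with w hw
    exact iteratedDerivWithin_of_isOpen hU hw
  rw [iteratedDeriv_succ]
  exact ((h1.differentiableAt (hU.mem_nhds hu)).congr_of_eventuallyEq h2.symm).hasDerivAt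

/-- The Taylor series at a point of `(0, x]` as a holomorphic function. -/
theorem exists_local_holomorphic {g : ℕ → ℝ → ℂ} {x r : ℝ} (hr : 0 < r)
    (hg : ∀ u ∈ Set.Ioc 0 x, ∀ k, HasDerivAt (g k) (g (k + 1) u) u)
    (hG : ∀ a, 0 < a → DerivGrowth g r (Set.Icc a x)) {t : ℝ} (ht : t ∈ Set.Ioc 0 x) :
    ∃ A : ℂ → ℂ, DifferentiableOn ℂ A (Metric.ball (t : ℂ) r) ∧
      ∀ s ∈ Set.Ioc 0 x, |s - t| < r → A s = g 0 s := by
  obtain ⟨C, hC⟩ := hG t ht.1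
  have hCt := hC t ⟨le_rfl, ht.2⟩
  have hrc : (r : ℂ) ≠ 0 := by exact_mod_cast hr.ne'
  set E : ℕ → ℂ := fun k => g k t * r ^ k / k ! with hE
  have hES : UnitDiscSummable E := by
    refine unitDiscSummable_of_norm_le (C := C) fun k => ?_
    have hC0 : 0 ≤ C := by
      have := (norm_nonneg _).trans (hCt 0)
      simpa using this
    rw [hE, norm_div, norm_mul, norm_pow, Complex.norm_real, Real.norm_eq_abs, abs_of_pos hr,
      Complex.norm_natCast]
    calc ‖g k t‖ * r ^ k / k ! ≤ C * (k ! / r ^ k) * r ^ k / k ! := by gcongr; exact hCt k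
      _ = C * 1 := by
        have : (k ! : ℝ) ≠ 0 := by positivity
        field_simp
      _ ≤ C * (k + 1) := by
        gcongr
        linarith [(Nat.cast_nonneg k : (0 : ℝ) ≤ k)]
  refine ⟨fun z => ∑' k, E k * ((z - t) / r) ^ k, ?_, fun s hs hst => ?_⟩
  · refine hES.differentiableOn.comp (g := fun z => ∑' k, E k * z ^ k) (by fun_prop) fun z hz => ?_
    rw [mem_ball_zero_iff, norm_div, Complex.norm_real, Real.norm_eq_abs, abs_of_pos hr,
      div_lt_one hr]
    exact mem_ball_iff_norm.1 hz
  · have hsub : Set.uIcc s t ⊆ Set.Icc (min s t) x := by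
      rw [Set.uIcc]
      exact Set.Icc_subset_Icc_right (max_le hs.2 ht.2)
    have hpos : 0 < min s t := lt_min hs.1 ht.1
    have h := hasSum_taylor hr (fun u hu => hg u ⟨hpos.trans_le (hsub hu).1, (hsub hu).2⟩)
      ((hG _ hpos).mono hsub) hst
    rw [← h.tsum_eq]
    refine tsum_congr fun k => ?_
    simp only [hE]
    rw [div_pow]
    push_cast
    field_simp

/-- The normalized Taylor coefficients at `x` of `v ↦ g_0 (x (1 - v))`. -/
noncomputable def scaledTaylorCoeff (g : ℕ → ℝ → ℂ) (x : ℝ) (k : ℕ) : ℂ :=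
  (-1) ^ k * x ^ k * g k x / k !

theorem analyticAt_real_of_complex {A : ℂ → ℂ} {ℓ : ℝ → ℂ} {t : ℝ} (hA : AnalyticAt ℂ A (ℓ t))
    (hℓ : AnalyticAt ℝ ℓ t) : AnalyticAt ℝ (fun s => A (ℓ s)) t :=
  (hA.restrictScalars (𝕜 := ℝ)).comp hℓ

/-- The Taylor series at `x` represents `g_0` on all of `(0, x]`. -/
theorem hasSum_scaledTaylorCoeff {g : ℕ → ℝ → ℂ} {x r : ℝ} (hx : 0 < x) (hr : 0 < r)
    (hg : ∀ u ∈ Set.Ioc 0 x, ∀ k, HasDerivAt (g k) (g (k + 1) u) u)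
    (hG : ∀ a, 0 < a → DerivGrowth g r (Set.Icc a x))
    (hD : UnitDiscSummable (scaledTaylorCoeff g x)) {v : ℝ} (hv : v ∈ Set.Ioo (0 : ℝ) 1) :
    HasSum (fun k => scaledTaylorCoeff g x k * (v : ℂ) ^ k) (g 0 (x * (1 - v))) := by
  have hxc : (x : ℂ) ≠ 0 := by exact_mod_cast hx.ne'
  set Φ : ℂ → ℂ := fun z => ∑' k, scaledTaylorCoeff g x k * z ^ k with hΦ
  set ℓ : ℝ → ℂ := fun s => ((x : ℂ) - s) / x with hℓ
  have hℓa : ∀ t, AnalyticAt ℝ ℓ t := fun t =>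
    (analyticAt_const.sub (Complex.ofRealCLM.analyticAt t)).div_const
  have hℓn : ∀ s ∈ Set.Ioo 0 x, ‖ℓ s‖ < 1 := by
    intro s hs
    have : ℓ s = (((x - s) / x : ℝ) : ℂ) := by rw [hℓ]; push_cast; rfl
    rw [this, Complex.norm_real, Real.norm_eq_abs, abs_div, abs_of_pos hx, div_lt_one hx,
      abs_of_pos (by linarith [hs.2])]
    linarith [hs.1]
  have h1 : AnalyticOnNhd ℝ (fun s => Φ (ℓ s)) (Set.Ioo 0 x) := fun t ht =>
    analyticAt_real_of_complex (hD.differentiableOn.analyticAt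
      (Metric.isOpen_ball.mem_nhds (mem_ball_zero_iff.2 (hℓn t ht)))) (hℓa t)
  have h2 : AnalyticOnNhd ℝ (g 0) (Set.Ioo 0 x) := by
    intro t ht
    obtain ⟨A, hA, hAg⟩ := exists_local_holomorphic hr hg hG ⟨ht.1, ht.2.le⟩
    have h3 := analyticAt_real_of_complex (ℓ := fun s : ℝ => (s : ℂ)) (t := t)
      (hA.analyticAt (Metric.ball_mem_nhds _ hr)) (Complex.ofRealCLM.analyticAt t)
    refine h3.congr ?_
    filter_upwards [Ioo_mem_nhds ht.1 ht.2, Metric.ball_mem_nhds t hr] with s hs hst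
    exact hAg s ⟨hs.1, hs.2.le⟩ hst
  have hnear : ∀ s ∈ Set.Ioo 0 x, |s - x| < r → Φ (ℓ s) = g 0 s := by
    intro s hs hsx
    have hsub : Set.uIcc s x ⊆ Set.Icc s x := (Set.uIcc_of_le hs.2.le).subset
    have h := hasSum_taylor hr (fun u hu => hg u ⟨hs.1.trans_le (hsub hu).1, (hsub hu).2⟩)
      ((hG s hs.1).mono hsub) hsx
    rw [← h.tsum_eq]
    refine tsum_congr fun k => ?_
    have e : ((s - x : ℝ) : ℂ) = -1 * (x * ℓ s) := by
      rw [hℓ]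
      push_cast
      field_simp
      ring
    rw [scaledTaylorCoeff, e, mul_pow, mul_pow]
    ring
  have hm : 0 < min x r := lt_min hx hr
  have hmx := min_le_left x r
  have hmr := min_le_right x r
  have hz₀ : x - min x r / 2 ∈ Set.Ioo 0 x := ⟨by linarith, by linarith⟩
  -- Taylor's theorem applies only within r of x; real analyticity of both sides on (0, x) carries
  -- the equality down to 0.
  have heq := h1.eqOn_of_preconnected_of_eventuallyEq h2 isPreconnected_Ioo hz₀ (by
    filter_upwards [Ioo_mem_nhds hz₀.1 hz₀.2, Ioo_mem_nhds (show x - r < x - min x r / 2 by linarith)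
      (show x - min x r / 2 < x by linarith)] with s hs hs'
    refine hnear s hs ?_
    rw [abs_lt]
    constructor <;> linarith [hs'.1, hs'.2])
  have hs : x * (1 - v) ∈ Set.Ioo 0 x :=
    ⟨mul_pos hx (by linarith [hv.2]), mul_lt_of_lt_one_right hx (by linarith [hv.1])⟩
  rw [← heq hs]
  have : ℓ (x * (1 - v)) = v := by
    rw [hℓ]
    push_cast
    field_simp
    ring
  simp only [this]
  exact hD.hasSum (norm_ofReal_lt_one hv)

/-- The scaled Taylor series at `x` is regular at the point corresponding to `0`, if `g_0` extends
holomorphically around `0`. -/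
theorem exists_analyticAt_one_of_extension {g : ℝ → ℂ} {D : ℕ → ℂ} {x ε : ℝ} (hx : 0 < x)
    (hε : 0 < ε) (hD : UnitDiscSummable D)
    (hsum : ∀ v ∈ Set.Ioo (0 : ℝ) 1, HasSum (fun k => D k * (v : ℂ) ^ k) (g (x * (1 - v))))
    {A : ℂ → ℂ} (hA : DifferentiableOn ℂ A (Metric.ball 0 ε))
    (hAg : ∀ s ∈ Set.Ioo 0 ε, s < x → A s = g s) :
    ∃ Φ : ℂ → ℂ, AnalyticAt ℂ Φ 1 ∧
      ∀ᶠ z in 𝓝 (1 : ℂ), ‖z‖ < 1 → Φ z = ∑' k, D k * z ^ k := by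
  have hεx : 0 < ε / x := by positivity
  have hdiff : DifferentiableOn ℂ (fun z : ℂ => A (x * (1 - z))) (Metric.ball 1 (ε / x)) := by
    refine hA.comp (by fun_prop) fun z hz => ?_
    rw [mem_ball_zero_iff, norm_mul, Complex.norm_real, Real.norm_eq_abs, abs_of_pos hx]
    rw [mem_ball_iff_norm, norm_sub_rev, lt_div_iff₀ hx] at hz
    linarith
  refine ⟨fun z => A (x * (1 - z)), hdiff.analyticAt (Metric.ball_mem_nhds 1 hεx), ?_⟩
  set V := Metric.ball (0 : ℂ) 1 ∩ Metric.ball 1 (ε / x) with hV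
  have hVconv : Convex ℝ V := (convex_ball _ _).inter (convex_ball _ _)
  have hmem : ∀ w : ℝ, 0 < w → w < 1 → 1 - ε / x < w →
      (w : ℂ) ∈ V ∧ A (x * (1 - w)) = ∑' k, D k * (w : ℂ) ^ k := by
    intro w hw0 hw1 hwε
    refine ⟨⟨mem_ball_zero_iff.2 (norm_ofReal_lt_one ⟨hw0, hw1⟩), ?_⟩, ?_⟩
    · rw [mem_ball_iff_norm, ← Complex.ofReal_one, ← Complex.ofReal_sub, Complex.norm_real,
        Real.norm_eq_abs, abs_of_neg (by linarith)]
      linarith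
    · rw [(hsum w ⟨hw0, hw1⟩).tsum_eq, ← hAg]
      · push_cast
        rfl
      · refine ⟨mul_pos hx (by linarith), ?_⟩
        have h1 : 1 - w < ε / x := by linarith
        rw [lt_div_iff₀ hx] at h1
        linarith
      · exact mul_lt_of_lt_one_right hx (by linarith)
  -- A real point of the lens V. The two holomorphic functions agree at all real points near it,
  -- hence on the connected set V.
  set w₀ : ℝ := 1 - min 1 (ε / x) / 2 with hw₀
  have hm : 0 < min 1 (ε / x) := lt_min one_pos hεx
  have hm1 := min_le_left 1 (ε / x)
  have hm2 := min_le_right 1 (ε / x)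
  have hev : ∀ᶠ w : ℝ in 𝓝[≠] w₀, A (x * (1 - w)) = ∑' k, D k * (w : ℂ) ^ k := by
    refine eventually_nhdsWithin_of_eventually_nhds ?_
    filter_upwards [lt_mem_nhds (show 0 < w₀ by rw [hw₀]; linarith),
      gt_mem_nhds (show w₀ < 1 by rw [hw₀]; linarith),
      lt_mem_nhds (show 1 - ε / x < w₀ by rw [hw₀]; linarith)] with w h0 h1 h2
    exact (hmem w h0 h1 h2).2
  have htend : Tendsto (fun w : ℝ => (w : ℂ)) (𝓝[≠] w₀) (𝓝[≠] (w₀ : ℂ)) := by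
    refine tendsto_nhdsWithin_of_tendsto_nhds_of_eventually_within _
      ((Complex.continuous_ofReal.tendsto w₀).mono_left nhdsWithin_le_nhds) ?_
    filter_upwards [self_mem_nhdsWithin] with w hw h
    exact hw (Complex.ofReal_injective h)
  have heq : Set.EqOn (fun z : ℂ => A (x * (1 - z))) (fun z => ∑' k, D k * z ^ k) V :=
    AnalyticOnNhd.eqOn_of_preconnected_of_frequently_eq
      (fun z hz => hdiff.analyticAt (Metric.isOpen_ball.mem_nhds hz.2))
      (fun z hz => hD.differentiableOn.analyticAt (Metric.isOpen_ball.mem_nhds hz.1))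
      hVconv.isPreconnected
      (hmem w₀ (by rw [hw₀]; linarith) (by rw [hw₀]; linarith) (by rw [hw₀]; linarith)).1
      (htend.frequently hev.frequently)
  filter_upwards [Metric.ball_mem_nhds 1 hεx] with z hz hz1
  exact heq ⟨mem_ball_zero_iff.2 hz1, hz⟩

/-- Near `0` the function is the restriction of a holomorphic function. -/
theorem exists_holomorphic_extension_zero {g : ℕ → ℝ → ℂ} {x r : ℝ} (hx : 0 < x) (hr : 0 < r)
    (hg : ∀ u ∈ Set.Ioc 0 x, ∀ k, HasDerivAt (g k) (g (k + 1) u) u)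
    (hG : ∀ a, 0 < a → DerivGrowth g r (Set.Icc a x)) :
    ∃ A : ℂ → ℂ, DifferentiableOn ℂ A (Metric.ball 0 (r / 2)) ∧
      ∀ s ∈ Set.Ioo 0 (r / 2), s < x → A s = g 0 s := by
  have hm : 0 < min x r := lt_min hx hr
  have hmx := min_le_left x r
  have hmr := min_le_right x r
  -- The centre lies within r/2 of 0, so its disc of radius r contains the disc of radius r/2 about
  -- 0. This needs r to be the same for all centres.
  obtain ⟨A, hA, hAg⟩ := exists_local_holomorphic hr hg hG (t := min x r / 2)
    ⟨by linarith, by linarith⟩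
  refine ⟨A, hA.mono (Metric.ball_subset_ball' ?_), fun s hs hsx => hAg s ⟨hs.1, hsx.le⟩ ?_⟩
  · rw [dist_eq_norm, zero_sub, norm_neg, Complex.norm_real, Real.norm_eq_abs,
      abs_of_pos (by linarith)]
    linarith
  · rw [abs_lt]
    constructor <;> linarith [hs.1, hs.2]

/-- Gluing a smooth function on `(0, b)` with a holomorphic extension around `0`. -/
theorem contDiffOn_glue {f : ℝ → ℂ} {b x ε : ℝ} (hx : 0 < x)
    (hf : ContDiffOn ℝ ∞ f (Set.Ioo 0 b)) (hε : 0 < ε) {A : ℂ → ℂ}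
    (hA : DifferentiableOn ℂ A (Metric.ball 0 ε)) (hAf : ∀ s ∈ Set.Ioo 0 ε, s < x → A s = f s) :
    ContDiffOn ℝ ∞ (fun t : ℝ => if 0 < t then f t else A t) (Set.Ioo (-ε) b) := by
  intro t ht
  refine ContDiffAt.contDiffWithinAt ?_
  rcases lt_or_ge 0 t with h | h
  · refine (hf.contDiffAt (Ioo_mem_nhds h ht.2)).congr_of_eventuallyEq ?_
    filter_upwards [lt_mem_nhds h] with s hs
    rw [if_pos hs]
  · have htA : (t : ℂ) ∈ Metric.ball (0 : ℂ) ε := by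
      rw [mem_ball_zero_iff, Complex.norm_real, Real.norm_eq_abs, abs_of_nonpos h]
      linarith [ht.1]
    have h1 := analyticAt_real_of_complex (ℓ := fun s : ℝ => (s : ℂ)) (t := t)
      (hA.analyticAt (Metric.isOpen_ball.mem_nhds htA)) (Complex.ofRealCLM.analyticAt t)
    refine h1.contDiffAt.congr_of_eventuallyEq ?_
    filter_upwards [gt_mem_nhds (show t < ε by linarith), gt_mem_nhds (show t < x by linarith)]
      with s hs hsx
    split_ifs with hs0
    · exact (hAf s ⟨hs0, hs⟩ hsx).symm
    · rfl

end

/-! ### The coefficients, and the case of ordinary derivatives. -/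

section

open scoped Nat

theorem succ_mul_choose_succ (α : ℂ) (k : ℕ) :
    ((k : ℂ) + 1) * Ring.choose α (k + 1) = Ring.choose α k * (α - k) := by
  have h1 : (k ! : ℂ) ≠ 0 := by exact_mod_cast Nat.factorial_ne_zero k
  have h2 : ((k : ℂ) + 1) ≠ 0 := by exact_mod_cast Nat.succ_ne_zero k
  rw [Ring.choose_eq_smul, Ring.choose_eq_smul, descPochhammer_succ_right, Polynomial.smeval_mul,
    Polynomial.smeval_sub, Polynomial.smeval_X, Polynomial.smeval_natCast, Nat.factorial_succ]
  simp only [smul_eq_mul, pow_one, pow_zero, nsmul_eq_mul, mul_one]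
  push_cast
  field_simp

theorem natCast_sub_ne_zero_of_forall_ne {α : ℂ} (hα : ∀ m : ℕ, α ≠ m) (k : ℕ) :
    (k : ℂ) - α ≠ 0 := fun h => hα k (sub_eq_zero.1 h).symm

theorem Gamma_neg_ne_zero_of_forall_ne {α : ℂ} (hα : ∀ m : ℕ, α ≠ m) (k : ℕ) :
    Complex.Gamma (k - α) ≠ 0 := by
  refine Complex.Gamma_ne_zero fun m h => hα (k + m) ?_
  push_cast
  linear_combination -h

/-- Closed form of the coefficients for `α` not a natural number. -/
theorem rlCoeff_eq {α : ℂ} (hα : ∀ m : ℕ, α ≠ m) (k : ℕ) :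
    rlCoeff α k = (-1) ^ k / (Complex.Gamma (-α) * k ! * (k - α)) := by
  have hΓ : Complex.Gamma (-α) ≠ 0 := by
    simpa using Gamma_neg_ne_zero_of_forall_ne hα 0
  have key : Ring.choose α k * (k ! * (k - α)) * Complex.Gamma (-α) =
      (-1) ^ k * Complex.Gamma (k - α + 1) := by
    induction k with
    | zero =>
      have h0 : -α ≠ 0 := by simpa using hα 0
      simp only [Ring.choose_zero_right, Nat.factorial_zero, Nat.cast_one, Nat.cast_zero, zero_sub,
        pow_zero, one_mul]
      rw [Complex.Gamma_add_one _ h0]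
    | succ k ih =>
      have h0 := natCast_sub_ne_zero_of_forall_ne hα (k + 1)
      have h1 : (k : ℂ) - α + 1 = ((k + 1 : ℕ) : ℂ) - α := by push_cast; ring
      rw [Complex.Gamma_add_one _ h0, ← h1, Nat.factorial_succ, pow_succ]
      push_cast
      have h2 := succ_mul_choose_succ α k
      linear_combination (k ! : ℂ) * (k - α + 1) * Complex.Gamma (-α) * h2 - (k - α + 1) * ih
  have hk := natCast_sub_ne_zero_of_forall_ne hα k
  have hΓk : Complex.Gamma (k - α + 1) ≠ 0 := by
    rw [Complex.Gamma_add_one _ hk]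
    exact mul_ne_zero hk (Gamma_neg_ne_zero_of_forall_ne hα k)
  have hfac : (k ! : ℂ) ≠ 0 := by exact_mod_cast Nat.factorial_ne_zero k
  rw [rlCoeff, div_eq_div_iff hΓk (by positivity)]
  linear_combination key

theorem rlOrder_sub_re_pos {α : ℂ} (hα : ∀ m : ℕ, α ≠ m) : 0 < ((rlOrder α : ℂ) - α).re := by
  rw [Complex.sub_re, Complex.natCast_re, sub_pos, rlOrder]
  split_ifs with h1 h2
  · refine lt_of_le_of_ne (Nat.le_ceil _) fun h => hα ⌈α.re⌉₊ ?_
    exact Complex.ext (by simpa using h) (by simpa using h1)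
  · simpa using h2
  · push_cast
    exact Nat.lt_floor_add_one _

theorem rlOrder_natCast (m : ℕ) : rlOrder (m : ℂ) = m := by
  simp [rlOrder]

/-- Below m the Gamma function sits at a pole, where its value 0 makes the quotient 0; above m the
binomial coefficient vanishes. -/
theorem rlCoeff_natCast (m k : ℕ) : rlCoeff (m : ℂ) k = if k = m then 1 else 0 := by
  rw [rlCoeff, Ring.choose_natCast]
  rcases lt_trichotomy k m with h | rfl | h
  · obtain ⟨d, rfl⟩ := Nat.exists_eq_add_of_lt h
    have : (k : ℂ) - ((k + d + 1 : ℕ) : ℂ) + 1 = -(d : ℂ) := by push_cast; ring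
    rw [this, Complex.Gamma_neg_nat_eq_zero, div_zero, if_neg h.ne]
  · simp
  · rw [Nat.choose_eq_zero_of_lt h, if_neg h.ne']
    simp

/-- The case of ordinary derivatives. -/
theorem rl_series_natCast (m : ℕ) {f : ℝ → ℂ} {b x : ℝ} (hx : 0 < x) (hxb : x < b)
    (hf : ContDiffOn ℝ ∞ f (Set.Ioo 0 b)) :
    RLDifferentiableAt m f x ∧
      Tendsto (fun N : ℕ => ∑ k ∈ Finset.range N, rlTerm m f x k) atTop (𝓝 (rlDeriv m f x)) := by
  have hid : rlIntegral 0 f = f := by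
    funext y
    simp [rlIntegral]
  have hfx : ContDiffAt ℝ ∞ f x := hf.contDiffAt (Ioo_mem_nhds hx hxb)
  have hterm : ∀ k, rlTerm m f x k = if k = m then iteratedDeriv m f x else 0 := by
    intro k
    rw [rlTerm, rlCoeff_natCast]
    split_ifs with h
    · subst h
      simp
    · simp
  rw [RLDifferentiableAt, rlDeriv, rlOrder_natCast, sub_self, hid]
  refine ⟨⟨fun h => absurd rfl h, hfx.of_le (by exact_mod_cast le_top)⟩, ?_⟩
  refine tendsto_const_nhds.congr' ?_
  filter_upwards [eventually_gt_atTop m] with N hN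
  simp [hterm, hN]

theorem rlIntegral_congr {β : ℂ} {f f₁ : ℝ → ℂ} (h : ∀ t, 0 < t → f t = f₁ t) {y : ℝ}
    (hy : 0 < y) : rlIntegral β f y = rlIntegral β f₁ y := by
  rw [rlIntegral, rlIntegral, h y hy]
  congr 2
  rw [intervalIntegral.integral_of_le hy.le, intervalIntegral.integral_of_le hy.le]
  refine MeasureTheory.setIntegral_congr_fun measurableSet_Ioc fun t ht => ?_
  simp only [h t ht.1]

theorem intervalIntegrable_rl {β : ℂ} (hβ : 0 < β.re) {f : ℝ → ℂ} {y : ℝ} (hy : 0 < y)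
    (hf : ContinuousOn f (Set.Icc 0 y)) :
    IntervalIntegrable (fun t : ℝ => f t * ((y - t : ℝ) : ℂ) ^ (β - 1))
      MeasureTheory.volume 0 y := by
  have h1 : IntervalIntegrable (fun v : ℝ => (v : ℂ) ^ (β - 1)) MeasureTheory.volume y 0 :=
    intervalIntegral.intervalIntegrable_cpow' (by simpa using hβ)
  have h2 := h1.comp_sub_left y
  rw [sub_self, sub_zero] at h2
  exact h2.continuousOn_mul (by rwa [Set.uIcc_of_le hy.le])

/-- Convergence of the terms `c_k ρ^k f^(k)(t)` to `0` bounds the Taylor coefficients at `t`. -/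
theorem exists_growth_bound {α : ℂ} (hα : ∀ m : ℕ, α ≠ m) {a : ℕ → ℂ} {ρ : ℝ} (hρ : 0 < ρ)
    (h : Tendsto (fun n : ℕ => rlCoeff α n * (ρ : ℂ) ^ n * a n) atTop (𝓝 0)) :
    ∃ C : ℝ, ∀ k : ℕ, ‖a k‖ ≤ C * (k + 1) * (k ! / ρ ^ k) := by
  obtain ⟨M, hM⟩ := h.norm.bddAbove_range
  have hΓ : Complex.Gamma (-α) ≠ 0 := by
    simpa using Gamma_neg_ne_zero_of_forall_ne hα 0
  refine ⟨M * ‖Complex.Gamma (-α)‖ * (1 + ‖α‖), fun k => ?_⟩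
  have hk := natCast_sub_ne_zero_of_forall_ne hα k
  have hMk : ‖rlCoeff α k * (ρ : ℂ) ^ k * a k‖ ≤ M := hM ⟨k, rfl⟩
  have hM0 : 0 ≤ M := (norm_nonneg _).trans hMk
  rw [rlCoeff_eq hα, norm_mul, norm_mul, norm_div, norm_mul, norm_mul, norm_pow, norm_pow, norm_neg,
    norm_one, one_pow, Complex.norm_natCast, Complex.norm_real, Real.norm_eq_abs,
    abs_of_pos hρ] at hMk
  have hΓn : 0 < ‖Complex.Gamma (-α)‖ := norm_pos_iff.2 hΓ
  have hkn : 0 < ‖(k : ℂ) - α‖ := norm_pos_iff.2 hk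
  have hle : ‖(k : ℂ) - α‖ ≤ (1 + ‖α‖) * (k + 1) := by
    have h1 := norm_sub_le (k : ℂ) α
    rw [Complex.norm_natCast] at h1
    have h2 : 0 ≤ ‖α‖ * k := by positivity
    nlinarith [norm_nonneg α]
  have hfac : (0 : ℝ) < k ! := by positivity
  calc ‖a k‖ = (1 / (‖Complex.Gamma (-α)‖ * k ! * ‖(k : ℂ) - α‖) * ρ ^ k * ‖a k‖) *
        (‖Complex.Gamma (-α)‖ * ‖(k : ℂ) - α‖ * (k ! / ρ ^ k)) := by
        field_simp
    _ ≤ M * (‖Complex.Gamma (-α)‖ * ((1 + ‖α‖) * (k + 1)) * (k ! / ρ ^ k)) := by gcongr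
    _ = _ := by ring

end

/-! ### The main theorem. -/

theorem mainTheorem5 (α : ℂ) (f : ℝ → ℂ) (b x ρ : ℝ)
    (hx : 0 < x) (hxb : x < b) (hρ : 0 < ρ)
    (hf : ContDiffOn ℝ ∞ f (Set.Ioo 0 b))
    (hclass : ∀ t ∈ Set.Ioc 0 x,
      Tendsto (fun n : ℕ => rlCoeff α n * (ρ : ℂ) ^ n * iteratedDeriv n f t) atTop (𝓝 0))
    (hterm : Tendsto (rlTerm α f x) atTop (𝓝 0)) :
    RLDifferentiableAt α f x ∧
      Tendsto (fun N : ℕ => ∑ k ∈ Finset.range N, rlTerm α f x k) atTop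
        (𝓝 (rlDeriv α f x)) := by
  by_cases hα' : ∃ m : ℕ, α = m
  · obtain ⟨m, rfl⟩ := hα'
    exact rl_series_natCast m hx hxb hf
  have hα : ∀ m : ℕ, α ≠ m := fun m h => hα' ⟨m, h⟩
  have hxc : (x : ℂ) ≠ 0 := by exact_mod_cast hx.ne'
  have hΓ : Complex.Gamma (-α) ≠ 0 := by
    simpa using Gamma_neg_ne_zero_of_forall_ne hα 0
  -- uniform bounds on the derivatives
  set g : ℕ → ℝ → ℂ := fun k => iteratedDeriv k f with hgdef
  have hgb : ∀ u ∈ Set.Ioo 0 b, ∀ k, HasDerivAt (g k) (g (k + 1) u) u :=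
    hasDerivAt_iteratedDeriv_of_contDiffOn isOpen_Ioo hf
  have hg : ∀ u ∈ Set.Ioc 0 x, ∀ k, HasDerivAt (g k) (g (k + 1) u) u :=
    fun u hu => hgb u ⟨hu.1, hu.2.trans_lt hxb⟩
  have hpt : ∀ t ∈ Set.Ioc 0 x, ∃ C : ℝ, ∀ k : ℕ, ‖g k t‖ ≤ C * (k.factorial / (ρ / 2) ^ k) := by
    intro t ht
    obtain ⟨C, hC⟩ := exists_growth_bound hα hρ (hclass t ht)
    have hC0 : 0 ≤ C := by
      have := (norm_nonneg _).trans (hC 0)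
      simpa using this
    refine ⟨C, fun k => (hC k).trans ?_⟩
    have h2 : (k : ℝ) + 1 ≤ 2 ^ k := by exact_mod_cast Nat.lt_two_pow_self
    calc C * (k + 1) * (k.factorial / ρ ^ k) ≤ C * 2 ^ k * (k.factorial / ρ ^ k) := by gcongr
      _ = _ := by
        rw [div_pow]
        field_simp
  -- One halving absorbs the factor k + 1 ≤ 2^k, the other is the loss in the Pringsheim–Boas
  -- theorem.
  set r := ρ / 2 / 2 with hr
  have hr0 : 0 < r := by positivity
  have hG : ∀ a, 0 < a → DerivGrowth g r (Set.Icc a x) := fun a ha =>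
    derivGrowth_Icc_of_pointwise (by positivity)
      (fun u hu => hg u ⟨ha.trans_le hu.1, hu.2⟩) fun t ht => hpt t ⟨ha.trans_le ht.1, ht.2⟩
  -- the scaled Taylor series at `x`
  set D := scaledTaylorCoeff g x with hDdef
  have hterm_eq : ∀ k, rlTerm α f x k =
      (x : ℂ) ^ (-α) / Complex.Gamma (-α) * (D k / (k + -α)) := by
    intro k
    have hk := natCast_sub_ne_zero_of_forall_ne hα k
    have hfac : (k.factorial : ℂ) ≠ 0 := by exact_mod_cast Nat.factorial_ne_zero k
    rw [rlTerm, rlCoeff_eq hα, sub_eq_add_neg (k : ℂ), Complex.cpow_add _ _ hxc,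
      Complex.cpow_natCast, hDdef, scaledTaylorCoeff]
    rw [sub_eq_add_neg] at hk
    field_simp
    rfl
  have hxα : (x : ℂ) ^ (-α) / Complex.Gamma (-α) ≠ 0 :=
    div_ne_zero (by simp [Complex.cpow_eq_zero_iff, hxc]) hΓ
  have he : Tendsto (fun k : ℕ => D k / (k + -α)) atTop (𝓝 0) := by
    have h1 := hterm.const_mul ((x : ℂ) ^ (-α) / Complex.Gamma (-α))⁻¹
    rw [mul_zero] at h1
    refine h1.congr fun k => ?_
    rw [hterm_eq, inv_mul_cancel_left₀ hxα]
  have hD : UnitDiscSummable D := by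
    -- Hypothesis 2 is the growth condition at x with ρ replaced by x; it yields D_k = O(k + 1).
    have h1 : Tendsto (fun n : ℕ => rlCoeff α n * (x : ℂ) ^ n * g n x) atTop (𝓝 0) := by
      have h2 := he.const_mul (Complex.Gamma (-α))⁻¹
      rw [mul_zero] at h2
      refine h2.congr fun k => ?_
      have hk := natCast_sub_ne_zero_of_forall_ne hα k
      have hfac : (k.factorial : ℂ) ≠ 0 := by exact_mod_cast Nat.factorial_ne_zero k
      rw [rlCoeff_eq hα, hDdef, scaledTaylorCoeff, ← sub_eq_add_neg]
      field_simp
    obtain ⟨C, hC⟩ := exists_growth_bound hα hx h1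
    refine unitDiscSummable_of_norm_le (C := C) fun k => ?_
    rw [hDdef, scaledTaylorCoeff, norm_div, norm_mul, norm_mul, norm_pow, norm_pow, norm_neg,
      norm_one, one_pow, one_mul, Complex.norm_natCast, Complex.norm_real, Real.norm_eq_abs,
      abs_of_pos hx]
    calc x ^ k * ‖g k x‖ / k.factorial ≤ x ^ k * (C * (k + 1) * (k.factorial / x ^ k)) / k.factorial := by
          gcongr
          exact hC k
      _ = C * (k + 1) := by
        have : (k.factorial : ℝ) ≠ 0 := by positivity
        field_simp
  have hsum : ∀ v ∈ Set.Ioo (0 : ℝ) 1,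
      HasSum (fun k => D k * (v : ℂ) ^ k) (g 0 (x * (1 - v))) :=
    fun v hv => hasSum_scaledTaylorCoeff hx hr0 hg hG hD hv
  have hg0 : g 0 = f := by
    funext t
    simp [hgdef]
  -- extension across `0`
  obtain ⟨A, hA, hAg⟩ := exists_holomorphic_extension_zero hx hr0 hg hG
  have hε : 0 < r / 2 := by positivity
  obtain ⟨Φ, hΦ, hΦeq⟩ := exists_analyticAt_one_of_extension hx hε hD hsum hA hAg
  have hne : ∀ k : ℕ, (k : ℂ) + -α ≠ 0 := fun k => by
    rw [← sub_eq_add_neg]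
    exact natCast_sub_ne_zero_of_forall_ne hα k
  obtain ⟨G, hGan, hGsum⟩ := exists_analyticAt_one_div_add hD hne hΦ hΦeq
  have hfatou := tendsto_sum_of_analyticAt_one he hGan hGsum
  rw [hg0] at hAg
  -- The values of f at t ≤ 0 are arbitrary and do not affect `rlIntegral` at y > 0; f₁ replaces
  -- them so that the function is smooth across 0.
  set f₁ : ℝ → ℂ := fun t => if 0 < t then f t else A t with hf₁
  have hf₁s : ContDiffOn ℝ ∞ f₁ (Set.Ioo (-(r / 2)) b) := contDiffOn_glue hx hf hε hA hAg
  have hff₁ : ∀ t, 0 < t → f t = f₁ t := fun t ht => by simp [hf₁, ht]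
  set g₁ : ℕ → ℝ → ℂ := fun k => iteratedDeriv k f₁ with hg₁def
  have hg₁ : ∀ u ∈ Set.Ioo (-(r / 2)) b, ∀ k, HasDerivAt (g₁ k) (g₁ (k + 1) u) u :=
    hasDerivAt_iteratedDeriv_of_contDiffOn isOpen_Ioo hf₁s
  have hg₁0 : g₁ 0 = f₁ := by
    funext t
    simp [hg₁def]
  -- the fractional derivative
  set n := rlOrder α with hn
  set β : ℂ := (n : ℂ) - α with hβdef
  have hβ : 0 < β.re := rlOrder_sub_re_pos hα
  have hxb' : x ∈ Set.Ioo 0 b := ⟨hx, hxb⟩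
  obtain ⟨hcd, hval⟩ := iteratedDeriv_rlIntegral hβ hε hg₁ hxb' n
  have hIeq : rlIntegral β f =ᶠ[𝓝 x] rlIntegral β (g₁ 0) := by
    rw [hg₁0]
    filter_upwards [lt_mem_nhds hx] with y hy
    exact rlIntegral_congr hff₁ hy
  have hderiv : rlDeriv α f x = rlIntegralDeriv β g₁ n x := by
    rw [rlDeriv, ← hn, ← hβdef, hIeq.iteratedDeriv_eq n, hval]
  refine ⟨⟨fun _ => ?_, hcd.congr_of_eventuallyEq hIeq⟩, ?_⟩
  · filter_upwards [Ioo_mem_nhds hx hxb] with y hy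
    have h1 : ContinuousOn f₁ (Set.Icc 0 y) := hf₁s.continuousOn.mono fun t ht =>
      ⟨by linarith [ht.1], by linarith [ht.2, hy.2]⟩
    refine (intervalIntegrable_rl hβ hy.1 h1).congr fun t ht => ?_
    rw [Set.uIoc_of_le hy.1.le] at ht
    simp only [← hff₁ t ht.1]
    rfl
  · have hβn : β - n = -α := by rw [hβdef]; ring
    have habel := tendsto_abel_rlIntegralDeriv hβ hε hxb' n hg₁ hD
      (fun v hv => by
        have hpos : 0 < x * (1 - v) := mul_pos hx (by linarith [hv.2])
        rw [hg₁0, ← hff₁ _ hpos, ← hg0]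
        exact hsum v hv)
      (by rwa [hβn])
    rw [hβn] at habel
    -- The Abel means also converge to the value of the continuation at 1, which is the Fatou limit
    -- of the partial sums; uniqueness of limits finishes the proof.
    have hG1 : Tendsto (fun s : ℝ => (x : ℂ) ^ (-α) / Complex.Gamma (-α) *
        ∑' k, D k / (k + -α) * (s : ℂ) ^ k) (𝓝[<] 1)
        (𝓝 ((x : ℂ) ^ (-α) / Complex.Gamma (-α) * G 1)) := by
      refine Tendsto.const_mul _ ?_
      refine (hGan.continuousAt.tendsto.comp ofReal_tendsto_one).congr' ?_
      filter_upwards [ofReal_tendsto_one.eventually hGsum, Ioo_mem_nhdsLT one_pos] with s hs hs1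
      exact (hs (norm_ofReal_lt_one hs1)).tsum_eq.symm
    rw [hderiv, tendsto_nhds_unique habel hG1]
    refine (hfatou.const_mul _).congr fun N => ?_
    rw [Finset.mul_sum]
    exact Finset.sum_congr rfl fun k _ => (hterm_eq k).symm
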